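/- **Corollary 3.1 (Meijer $G$ reduction with dilogarithm).** Let $a\in\mathbb{R}$ and $x>0$. Then $$G^{2,3}_{3,3}\bigg(x\;\bigg|\;{a+\frac12,\,a,\,a\atop a,\,a,\,a-\frac12}\bigg)=2x^{a-1/2}\bigg[\frac{\pi^2}{6}-\mathrm{Li}_2(1-\sqrt{x})-\mathrm{Li}_2(-\sqrt{x})-\ln(\sqrt{x})\ln(1+\sqrt{x})\bigg].$$ Here the Meijer $G$-function is given by the contour integral $$G^{m,n}_{p,q}\bigg(x\;\bigg|\;{a_1,\ldots,a_p\atop b_1,\ldots,b_q}\bigg)=\frac{1}{2\pi\mathrm{i}}\int_L\frac{\prod_{j=1}^m\Gamma(b_j-s)\prod_{j=1}^n\Gamma(1-a_j+s)}{\prod_{j=n+1}^p\Gamma(a_j-s)\prod_{j=m+1}^q\Gamma(1-b_j+s)}\,x^s\,\mathrm{d}s$$ (empty products being $1$), where the integration path $L$ is any $C^1$ path from $-\mathrm{i}\infty$ to $+\mathrm{i}\infty$, running upwards along a vertical line $\operatorname{Re}s=c$ outside a bounded parameter interval, that separates the poles of the factors $\Gamma(b_j-s)$, $1\le j\le m$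 (which lie to the right of $L$, i.e. in the component of $\mathbb{C}\setminus L$ containing all large positive reals), from those of the factors $\Gamma(1-a_j+s)$, $1\le j\le n$ (which lie to the left, i.e. in the component containing all large negative reals). The assertion includes that such paths exist, and that for each of them the integral converges absolutely and has the stated value. The dilogarithm $\mathrm{Li}_2$ is the analytic continuation to $\mathbb{C}\setminus[1,\infty)$ of the power series $\sum_{k=1}^\infty z^k/k^2$, $|z|<1$; equivalently, $\mathrm{Li}_2(z)=-\int_0^z\frac{\ln(1-u)}{u}\,\mathrm{d}u$ along the segment from $0$ to $z$, with the principal logarithm. -/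

import Mathlib

noncomputable section

open Complex MeasureTheory Filter Topology

/-- The integrand of the Meijer `G`-function `G^{m,n}_{p,q}(x | a₁, …, a_p ; b₁, …, b_q)`
(for `m ≤ q`, `n ≤ p`), without the factor `1 / (2πi)`. The parameters are indexed from `0`, so
`j ≤ m` in the usual indexing is `j.val < m` here. -/
def meijerIntegrand (m n : ℕ) {p q : ℕ} (a : Fin p → ℂ) (b : Fin q → ℂ) (x : ℝ) (s : ℂ) : ℂ :=
  ((∏ j : Fin q with j.val < m, Gamma (b j - s)) *
      (∏ j : Fin p with j.val < n, Gamma (1 - a j + s))) /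
    ((∏ j : Fin p with n ≤ j.val, Gamma (a j - s)) *
      (∏ j : Fin q with m ≤ j.val, Gamma (1 - b j + s))) * (x : ℂ) ^ s

/-- `γ` parametrizes an integration path `L` from `-i∞` to `+i∞` for the Meijer `G`-function: it is
continuously differentiable, it runs upwards along a fixed vertical line outside a bounded
parameter interval, and it separates the poles of the factors `Γ(b_j - s)`, `j ≤ m`, from those of
the factors `Γ(1 - a_j + s)`, `j ≤ n`. The former (where `b_j - s = -k`, `k = 0, 1, …`) lie on the
right of the path, that is in the component of the complement of `L` that contains all large
positive reals; the latter (where `1 - a_j + s = -k`) lie on the left, in the component that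
contains all large negative reals. -/
structure IsMeijerContour (m n : ℕ) {p q : ℕ} (a : Fin p → ℂ) (b : Fin q → ℂ) (γ : ℝ → ℂ) :
    Prop where
  contDiff : ContDiff ℝ 1 γ
  vertical_ends : ∃ c R : ℝ, ∀ t : ℝ, R ≤ |t| → γ t = c + t * I
  poles_right : ∀ j : Fin q, j.val < m → ∀ s : ℂ, (∃ k : ℕ, b j - s = -(k : ℂ)) →
    ∀ᶠ r : ℝ in atTop, JoinedIn (Set.range γ)ᶜ s (r : ℂ)
  poles_left : ∀ j : Fin p, j.val < n → ∀ s : ℂ, (∃ k : ℕ, 1 - a j + s = -(k : ℂ)) →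
    ∀ᶠ r : ℝ in atBot, JoinedIn (Set.range γ)ᶜ s (r : ℂ)

/-- The Meijer `G`-function `G^{m,n}_{p,q}(x | a ; b)` exists and has the value `w`: there is an
admissible integration path, and along every admissible path the contour integral
`(1 / (2πi)) ∫_L … ds` converges absolutely and equals `w`. (So there is at most one such `w`.) -/
def HasMeijerG (m n : ℕ) {p q : ℕ} (a : Fin p → ℂ) (b : Fin q → ℂ) (x : ℝ) (w : ℂ) : Prop :=
  (∃ γ : ℝ → ℂ, IsMeijerContour m n a b γ) ∧
  ∀ γ : ℝ → ℂ, IsMeijerContour m n a b γ →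
    Integrable (fun t : ℝ => meijerIntegrand m n a b x (γ t) * deriv γ t) ∧
    (1 / (2 * Real.pi * I)) * ∫ t : ℝ, meijerIntegrand m n a b x (γ t) * deriv γ t = w

/-- The dilogarithm `Li₂(z) = -∫₀^z log(1 - u) / u du` (along the segment, `u = t z`), on the plane
cut along `[1, ∞)`. The two theorems below show that it is the analytic continuation of the power
series `∑_{k ≥ 1} z ^ k / k ^ 2` to the cut plane. -/
def dilog (z : ℂ) : ℂ := -∫ t in (0 : ℝ)..1, log (1 - t * z) / t

theorem dilog_hasSum {z : ℂ} (hz : ‖z‖ < 1) :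
    HasSum (fun k : ℕ => z ^ (k + 1) / ((k : ℂ) + 1) ^ 2) (dilog z) := by
  have h := intervalIntegral.hasSum_integral_of_dominated_convergence (μ := volume)
    (a := (0 : ℝ)) (b := 1)
    (F := fun (k : ℕ) (t : ℝ) => (t : ℂ) ^ k * (z ^ (k + 1) / ((k : ℂ) + 1)))
    (f := fun t : ℝ => -(log (1 - t * z) / t))
    (bound := fun k _ => ‖z‖ ^ (k + 1)) ?_ ?_ ?_ ?_ ?_
  · rw [intervalIntegral.integral_neg] at h
    refine h.congr_fun ?_
    intro k
    rw [intervalIntegral.integral_mul_const]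
    have : ∫ t in (0 : ℝ)..1, (t : ℂ) ^ k = 1 / ((k : ℂ) + 1) := by
      have h2 := integral_pow (a := (0 : ℝ)) (b := 1) k
      have h3 : ∫ t in (0 : ℝ)..1, (t : ℂ) ^ k = ((∫ t in (0 : ℝ)..1, t ^ k : ℝ) : ℂ) := by
        rw [← intervalIntegral.integral_ofReal]; simp
      rw [h3, h2]; simp
    rw [this]
    have hk : (k : ℂ) + 1 ≠ 0 := by exact_mod_cast k.succ_ne_zero
    field_simp
  · intro k
    exact (by fun_prop : Continuous fun t : ℝ =>
      (t : ℂ) ^ k * (z ^ (k + 1) / ((k : ℂ) + 1))).aestronglyMeasurable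
  · intro k
    refine Eventually.of_forall fun t ht => ?_
    rw [Set.uIoc_of_le zero_le_one] at ht
    have h1 : ‖(t : ℂ)‖ ^ k ≤ 1 := by
      apply pow_le_one₀ (norm_nonneg _)
      rw [Complex.norm_real, Real.norm_of_nonneg ht.1.le]; exact ht.2
    have h2 : (1 : ℝ) ≤ ‖(k : ℂ) + 1‖ := by
      have : (k : ℂ) + 1 = ((k + 1 : ℕ) : ℂ) := by push_cast; ring
      rw [this, Complex.norm_natCast]; exact_mod_cast Nat.le_add_left 1 k
    rw [norm_mul, norm_div, norm_pow, norm_pow]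
    calc ‖(t : ℂ)‖ ^ k * (‖z‖ ^ (k + 1) / ‖(k : ℂ) + 1‖)
        ≤ 1 * ‖z‖ ^ (k + 1) := by
          gcongr
          exact div_le_self (by positivity) h2
      _ = _ := one_mul _
  · exact Eventually.of_forall fun t _ =>
      (summable_nat_add_iff 1).2 (summable_geometric_of_lt_one (norm_nonneg _) hz)
  · simp
  · refine Eventually.of_forall fun t ht => ?_
    rw [Set.uIoc_of_le zero_le_one] at ht
    have ht0 : (t : ℂ) ≠ 0 := by exact_mod_cast ht.1.ne'
    have h1 : ‖(t : ℂ) * z‖ < 1 := by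
      rw [norm_mul, Complex.norm_real, Real.norm_of_nonneg ht.1.le]
      nlinarith [norm_nonneg z, ht.1, ht.2]
    have h2 := (hasSum_nat_add_iff' 1).2 (Complex.hasSum_taylorSeries_neg_log h1)
    have h3 := h2.div_const (t : ℂ)
    have h4 : (-log (1 - t * z) - ∑ i ∈ Finset.range 1, ((t : ℂ) * z) ^ i / (i : ℂ)) / t
        = -(log (1 - t * z) / t) := by simp [neg_div]
    rw [h4] at h3
    refine h3.congr_fun fun k => ?_
    have hk : ((k + 1 : ℕ) : ℂ) ≠ 0 := by exact_mod_cast k.succ_ne_zero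
    push_cast at hk ⊢
    field_simp
    rw [mul_pow]
    ring

theorem dilog_analyticOnNhd : AnalyticOnNhd ℂ dilog {z : ℂ | 1 - z ∈ slitPlane} := by
  have hopen : IsOpen {z : ℂ | 1 - z ∈ slitPlane} :=
    isOpen_slitPlane.preimage (by fun_prop)
  have hstar : ∀ z : ℂ, 1 - z ∈ slitPlane → ∀ t : ℝ, t ∈ Set.Icc (0 : ℝ) 1 →
      1 - t * z ∈ slitPlane := by
    intro z hz t ht
    rw [Complex.mem_slitPlane_iff] at hz ⊢
    simp only [sub_re, one_re, sub_im, one_im, mul_re, ofReal_re, ofReal_im, zero_mul, sub_zero,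
      mul_im, add_zero, zero_sub, ne_eq, neg_eq_zero] at hz ⊢
    rcases ht.1.eq_or_lt with h | h
    · left; rw [← h]; simp
    · rcases hz with hz | hz
      · left; nlinarith [ht.2]
      · right; exact mul_ne_zero h.ne' hz
  apply DifferentiableOn.analyticOnNhd _ hopen
  intro z₀ hz₀
  obtain ⟨ε, hε, hball⟩ := Metric.nhds_basis_closedBall.mem_iff.1 (hopen.mem_nhds hz₀)
  -- a uniform bound for `‖w / (1 - t w)‖` and `‖1 / (1 - t w)‖`
  have hK : IsCompact (Set.Icc (0 : ℝ) 1 ×ˢ Metric.closedBall z₀ ε) :=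
    isCompact_Icc.prod (isCompact_closedBall _ _)
  obtain ⟨C, hC⟩ := hK.exists_bound_of_continuousOn
    (f := fun x : ℝ × ℂ => (-1 / (1 - x.1 * x.2) : ℂ)) (by
      refine ContinuousOn.div (by fun_prop) (by fun_prop) ?_
      rintro ⟨t, w⟩ ⟨ht, hw⟩
      exact slitPlane_ne_zero (hstar w (hball hw) t ht))
  have hderiv : ∀ w ∈ Metric.closedBall z₀ ε, ∀ t ∈ Set.Ioc (0 : ℝ) 1,
      HasDerivAt (fun w : ℂ => log (1 - t * w) / t) (-1 / (1 - t * w)) w := by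
    intro w hw t ht
    have hs := hstar w (hball hw) t ⟨ht.1.le, ht.2⟩
    have h1 : HasDerivAt (fun w : ℂ => 1 - (t : ℂ) * w) (-(t : ℂ)) w := by
      simpa using ((hasDerivAt_id w).const_mul (t : ℂ)).const_sub 1
    have ht0 : (t : ℂ) ≠ 0 := by exact_mod_cast ht.1.ne'
    refine ((h1.clog hs).div_const (t : ℂ)).congr_deriv ?_
    have := slitPlane_ne_zero hs
    field_simp
  have hmeas : ∀ w ∈ Metric.closedBall z₀ ε, AEStronglyMeasurable
      (fun t : ℝ => log (1 - t * w) / t) (volume.restrict (Set.uIoc (0 : ℝ) 1)) := by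
    intro w hw
    rw [Set.uIoc_of_le zero_le_one]
    refine ContinuousOn.aestronglyMeasurable ?_ measurableSet_Ioc
    refine ContinuousOn.div (ContinuousOn.clog (by fun_prop) ?_) (by fun_prop) ?_
    · exact fun t ht => hstar w (hball hw) t ⟨ht.1.le, ht.2⟩
    · intro t ht
      exact_mod_cast ht.1.ne'
  have hz₀b : z₀ ∈ Metric.closedBall z₀ ε := Metric.mem_closedBall_self hε.le
  have hint : IntervalIntegrable (fun t : ℝ => log (1 - t * z₀) / t) volume 0 1 := by
    have hb : ∀ t ∈ Set.Ioc (0 : ℝ) 1, ‖log (1 - t * z₀) / t‖ ≤ C * ‖z₀‖ := by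
      intro t ht
      have hd : ∀ u ∈ Set.Icc (0 : ℝ) 1, HasDerivWithinAt (fun u : ℝ => log (1 - u * z₀))
          (-1 / (1 - u * z₀) * z₀) (Set.Icc (0 : ℝ) 1) u := by
        intro u hu
        have h1 : HasDerivAt (fun u : ℝ => 1 - (u : ℂ) * z₀) (-z₀) u := by
          simpa using ((Complex.ofRealCLM.hasDerivAt (x := u)).mul_const z₀).const_sub 1
        refine ((h1.clog_real (hstar z₀ hz₀ u hu)).congr_deriv ?_).hasDerivWithinAt
        ring
      have h := (convex_Icc (0 : ℝ) 1).norm_image_sub_le_of_norm_hasDerivWithin_le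
        (C := C * ‖z₀‖) hd (fun u hu => by
          rw [norm_mul]
          exact mul_le_mul_of_nonneg_right (hC (u, z₀) ⟨hu, hz₀b⟩) (norm_nonneg _))
        (Set.left_mem_Icc.2 zero_le_one) (Set.mem_Icc.2 ⟨ht.1.le, ht.2⟩)
      simp only [ofReal_zero, zero_mul, sub_zero, log_one] at h
      rw [norm_div, Complex.norm_real, div_le_iff₀ (by simpa using ht.1.ne')]
      exact h
    rw [intervalIntegrable_iff, Set.uIoc_of_le zero_le_one]
    have hm := hmeas z₀ hz₀b
    rw [Set.uIoc_of_le zero_le_one] at hm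
    exact (integrable_const (C * ‖z₀‖)).mono' hm
      ((ae_restrict_iff' measurableSet_Ioc).2 (Eventually.of_forall hb))
  have key := intervalIntegral.hasDerivAt_integral_of_dominated_loc_of_deriv_le
    (μ := volume) (a := (0 : ℝ)) (b := 1) (x₀ := z₀)
    (F := fun (w : ℂ) (t : ℝ) => log (1 - t * w) / t)
    (F' := fun (w : ℂ) (t : ℝ) => -1 / (1 - t * w)) (bound := fun _ => C)
    (Metric.closedBall_mem_nhds z₀ hε)
    (by filter_upwards [Metric.closedBall_mem_nhds z₀ hε] with w hw using hmeas w hw)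
    hint
    (by
      rw [Set.uIoc_of_le zero_le_one]
      refine ContinuousOn.aestronglyMeasurable ?_ measurableSet_Ioc
      refine ContinuousOn.div (by fun_prop) (by fun_prop) ?_
      exact fun t ht => slitPlane_ne_zero (hstar z₀ hz₀ t ⟨ht.1.le, ht.2⟩))
    (by
      refine Eventually.of_forall fun t ht w hw => ?_
      rw [Set.uIoc_of_le zero_le_one] at ht
      exact hC (t, w) ⟨⟨ht.1.le, ht.2⟩, hw⟩)
    (by simp)
    (by
      refine Eventually.of_forall fun t ht w hw => ?_
      rw [Set.uIoc_of_le zero_le_one] at ht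
      exact hderiv w hw t ht)
  exact key.2.differentiableAt.neg.differentiableWithinAt

end

noncomputable section

open Complex MeasureTheory Filter Topology

/-! Put `s = a + u`. By the reflection formula and `Γ(u + 3/2) = (u + 1/2) Γ(u + 1/2)`, the
integrand becomes `x ^ a` times `(π / sin πu)² x ^ u / (u + 1/2)`
(`meijerIntegrand_eq_reducedIntegrand`). The poles to be separated are `0, 1, 2, …` on the right and
`-1/2, -1, -2, …` on the left.

An admissible path may wind and cross itself, so contours are compared through logarithmic integrals
rather than by deformation. Joinability to far real points determines the side index of every pole
(`HasSideIndex.of_joinedIn`). In a strip containing both paths, the integrand minus its simple pole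
parts has a primitive. The two integrals therefore differ by residues weighted by differences of
side indices (`integral_sub_integral_eq_sum_residues`). These differences vanish, so every path
gives the value on `Re u = -1/4` (`integral_reducedIntegrand`).

That value is found from a differential equation. Let `J(x)` be the line integral without the
denominator `u + 1/2`. Moving the line by one multiplies `J` by `x` and crosses the double pole at
`0`, of residue `log x`, so `(x - 1) J(x) = 2π log x`. Multiplying the wanted integral by `x ^
(1/2)` makes differentiation cancel the denominator. With `x = y²`, the derivative in `y` is `8π log
y / (y² - 1)`, which is also that of `4π` times the dilogarithm bracket. Both sides tend to `0` as
`y → 0+`, the bracket because `Li₂(1) = π²/6`; hence they agree (`lineValue_sq`). -/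

/-- The logarithmic integral of `γ` about `z` over `[-T, T]` is, for large `T`, the one predicted by
the principal logarithm at the end points on the line `Re = c`, up to `2πi e`. For a path with
vertical ends, `e` is `0` or `1` according to whether `z` is on the left or on the right. -/
def HasSideIndex (γ : ℝ → ℂ) (c : ℝ) (z e : ℂ) : Prop :=
  ∀ᶠ T : ℝ in atTop, ∫ t in -T..T, deriv γ t / (γ t - z) =
    log (c + T * I - z) - log (c - T * I - z) - 2 * Real.pi * I * e

theorem Complex.log_neg_of_im_pos {w : ℂ} (hw : 0 < w.im) : log (-w) = log w - Real.pi * I := by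
  simp only [log, norm_neg, arg_neg_eq_arg_sub_pi_of_im_pos hw]
  push_cast; ring

theorem Complex.log_neg_of_im_neg {w : ℂ} (hw : w.im < 0) : log (-w) = log w + Real.pi * I := by
  simp only [log, norm_neg, arg_neg_eq_arg_add_pi_of_im_neg hw]
  push_cast; ring

/-! ### Side indices of paths with vertical ends. -/

section Path

variable {γ : ℝ → ℂ}

theorem hasDerivAt_of_contDiff_one (hγ : ContDiff ℝ 1 γ) (t : ℝ) : HasDerivAt γ (deriv γ t) t :=
  ((hγ.differentiable one_ne_zero) t).hasDerivAt

theorem continuous_deriv_of_contDiff_one (hγ : ContDiff ℝ 1 γ) : Continuous (deriv γ) :=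
  hγ.continuous_deriv le_rfl

theorem continuous_deriv_div_sub (hγ : ContDiff ℝ 1 γ) {z : ℂ} (hz : z ∈ (Set.range γ)ᶜ) :
    Continuous fun t => deriv γ t / (γ t - z) := by
  refine (continuous_deriv_of_contDiff_one hγ).div (hγ.continuous.sub continuous_const) ?_
  exact fun t h => hz ⟨t, sub_eq_zero.1 h⟩

theorem integral_deriv_div_of_re_pos (hγ : ContDiff ℝ 1 γ) {z : ℂ} (hz : ∀ t, 0 < (γ t - z).re)
    (T : ℝ) :
    ∫ t in -T..T, deriv γ t / (γ t - z) = log (γ T - z) - log (γ (-T) - z) := by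
  have hz' : z ∈ (Set.range γ)ᶜ := by
    rintro ⟨t, rfl⟩
    simpa using hz t
  refine intervalIntegral.integral_eq_sub_of_hasDerivAt (f := fun t => log (γ t - z)) (fun t _ => ?_)
    ((continuous_deriv_div_sub hγ hz').intervalIntegrable _ _)
  exact ((hasDerivAt_of_contDiff_one hγ t).sub_const z).clog_real (Or.inl (hz t))

theorem hasSideIndex_zero_of_re_pos (hγ : ContDiff ℝ 1 γ) {c R : ℝ}
    (hc : ∀ t : ℝ, R ≤ |t| → γ t = c + t * I) {z : ℂ} (hz : ∀ t, 0 < (γ t - z).re) :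
    HasSideIndex γ c z 0 := by
  filter_upwards [eventually_ge_atTop R, eventually_ge_atTop 0] with T hT hT0
  rw [integral_deriv_div_of_re_pos hγ hz, hc T (by rwa [abs_of_nonneg hT0]),
    hc (-T) (by rwa [abs_neg, abs_of_nonneg hT0])]
  push_cast
  ring_nf

/-- The reflected path `-γ` stays to the right of `-z`, where the principal logarithm is a
primitive. Returning from `log (-w)` to `log w` costs `-πi` at the upper end and `+πi` at the lower
one, which together give the index `1`. -/
theorem hasSideIndex_one_of_re_neg (hγ : ContDiff ℝ 1 γ) {c R : ℝ}
    (hc : ∀ t : ℝ, R ≤ |t| → γ t = c + t * I) {z : ℂ} (hz : ∀ t, (γ t - z).re < 0) :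
    HasSideIndex γ c z 1 := by
  filter_upwards [eventually_ge_atTop R, eventually_gt_atTop 0, eventually_gt_atTop |z.im|]
    with T hT hT0 hTz
  have h := integral_deriv_div_of_re_pos (γ := fun t => -γ t) hγ.neg (z := -z)
    (fun t => by have := hz t; simp only [sub_re, neg_re] at this ⊢; linarith) T
  have e : ∀ t, deriv (fun t => -γ t) t / (-γ t - -z) = deriv γ t / (γ t - z) := by
    intro t
    rw [deriv.fun_neg, ← neg_div_neg_eq]
    congr 1 <;> ring
  simp only [e] at h
  have hz1 := abs_lt.1 hTz
  rw [h, hc T (by rwa [abs_of_pos hT0]), hc (-T) (by rwa [abs_neg, abs_of_pos hT0]),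
    show -((c : ℂ) + T * I) - -z = -(c + T * I - z) by ring,
    show -((c : ℂ) + (-T : ℝ) * I) - -z = -(c - T * I - z) by push_cast; ring,
    log_neg_of_im_pos (by simp; linarith), log_neg_of_im_neg (by simp; linarith)]
  ring

theorem exp_integral_deriv_div (hγ : ContDiff ℝ 1 γ) {z : ℂ} (hz : z ∈ (Set.range γ)ᶜ) (a b : ℝ) :
    exp (∫ t in a..b, deriv γ t / (γ t - z)) * (γ a - z) = γ b - z := by
  have hcont := continuous_deriv_div_sub hγ hz
  have hne : ∀ t, γ t - z ≠ 0 := fun t h => hz ⟨t, sub_eq_zero.1 h⟩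
  -- `exp (-W) (γ - z)` has zero derivative, so no branch of the logarithm along `γ` is needed.
  set W : ℝ → ℂ := fun s => ∫ t in a..s, deriv γ t / (γ t - z) with hW
  have hd : ∀ s, HasDerivAt (fun s => exp (-W s) * (γ s - z)) 0 s := by
    intro s
    have h1 : HasDerivAt W (deriv γ s / (γ s - z)) s := hcont.integral_hasStrictDerivAt a s |>.hasDerivAt
    refine (h1.neg.cexp.mul ((hasDerivAt_of_contDiff_one hγ s).sub_const z)).congr_deriv ?_
    have := hne s
    field_simp
    ring
  have h := is_const_of_deriv_eq_zero (fun s => (hd s).differentiableAt) (fun s => (hd s).deriv) b a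
  have hWa : W a = 0 := by simp [hW]
  simp only [hWa, neg_zero, exp_zero, one_mul] at h
  rw [← h, ← mul_assoc, ← exp_add]
  simp [hW]

theorem eq_of_continuous_unitInterval_of_exp_eq_one {q : unitInterval → ℂ} (hq : Continuous q)
    (h : ∀ τ, exp (q τ) = 1) (σ τ : unitInterval) : q σ = q τ := by
  have hpi : (2 * Real.pi * I : ℂ) ≠ 0 := two_pi_I_ne_zero
  choose n hn using fun τ => exp_eq_one_iff.1 (h τ)
  have hre : ∀ τ, (q τ / (2 * Real.pi * I)).re = n τ := by
    intro τ
    rw [hn τ, mul_div_assoc, div_self hpi]; simp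
  have hdisc : IsDiscrete (Set.range ((↑) : ℤ → ℝ)) :=
    Int.isClosedEmbedding_coe_real.isEmbedding.isDiscrete_range
  have := isPreconnected_univ.constant_of_mapsTo hdisc
    (f := fun τ => (q τ / (2 * Real.pi * I)).re)
    (by fun_prop) (fun τ _ => ⟨n τ, (hre τ).symm⟩) (Set.mem_univ σ) (Set.mem_univ τ)
  simp only [hre] at this
  rw [hn σ, hn τ]
  norm_cast
  rw [show n σ = n τ by exact_mod_cast this]

/-- The side index is constant along paths in the complement of `γ`. -/
theorem HasSideIndex.of_joinedIn (hγ : ContDiff ℝ 1 γ) {c R : ℝ}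
    (hc : ∀ t : ℝ, R ≤ |t| → γ t = c + t * I) {z w e : ℂ} (hzw : JoinedIn (Set.range γ)ᶜ z w)
    (hw : HasSideIndex γ c w e) : HasSideIndex γ c z e := by
  obtain ⟨p, hp⟩ := hzw
  obtain ⟨M, hM⟩ := isCompact_univ.exists_bound_of_continuousOn (f := fun τ => (p τ).im)
    (by fun_prop)
  -- Beyond the height `M` of the joining path, the two end-point logarithms never meet the branch
  -- cut, so `D` is continuous. Then `W - D` is continuous with values in `2πi ℤ`, hence constant.
  filter_upwards [hw, eventually_ge_atTop R, eventually_gt_atTop 0, eventually_gt_atTop M]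
    with T hwT hT hT0 hTM
  have him : ∀ τ, |(p τ).im| < T := fun τ => (hM τ trivial).trans_lt hTM
  have htop : ∀ τ, 0 < ((c : ℂ) + T * I - p τ).im := by
    intro τ; have := abs_lt.1 (him τ); simp; linarith
  have hbot : ∀ τ, ((c : ℂ) - T * I - p τ).im < 0 := by
    intro τ; have := abs_lt.1 (him τ); simp; linarith
  set W : unitInterval → ℂ := fun τ => ∫ t in -T..T, deriv γ t / (γ t - p τ) with hW
  set D : unitInterval → ℂ := fun τ => log (c + T * I - p τ) - log (c - T * I - p τ) with hD
  have hWc : Continuous W := by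
    refine intervalIntegral.continuous_parametric_intervalIntegral_of_continuous' ?_ _ _
    have h1 := continuous_deriv_of_contDiff_one hγ
    have h2 := hγ.continuous
    refine Continuous.div (by fun_prop) (by fun_prop) ?_
    rintro ⟨τ, t⟩ h
    exact hp τ ⟨t, sub_eq_zero.1 h⟩
  have hDc : Continuous D := by
    refine Continuous.sub (Continuous.clog (by fun_prop) ?_) (Continuous.clog (by fun_prop) ?_)
    · exact fun τ => Or.inr (htop τ).ne'
    · exact fun τ => Or.inr (hbot τ).ne
  have hexp : ∀ τ, exp (W τ - D τ) = 1 := by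
    intro τ
    have ht : (c : ℂ) + T * I - p τ ≠ 0 := fun h => by simpa [h] using htop τ
    have hb : (c : ℂ) - T * I - p τ ≠ 0 := fun h => by simpa [h] using hbot τ
    have h := exp_integral_deriv_div hγ (hp τ) (-T) T
    rw [hc T (by rwa [abs_of_pos hT0]), hc (-T) (by rwa [abs_neg, abs_of_pos hT0])] at h
    rw [exp_sub, exp_sub, exp_log ht, exp_log hb]
    push_cast at h
    rw [← h, show (c : ℂ) + -T * I - p τ = c - T * I - p τ by ring, mul_div_assoc, div_self hb,
      mul_one, div_self (exp_ne_zero _)]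
  have := eq_of_continuous_unitInterval_of_exp_eq_one (hWc.sub hDc) hexp 0 1
  simp only [Pi.sub_apply, hW, hD, p.source, p.target, hwT] at this
  linear_combination this

theorem exists_bound_re (hγ : Continuous γ) {c R : ℝ} (hc : ∀ t : ℝ, R ≤ |t| → γ t = c + t * I) :
    ∃ M : ℝ, ∀ t, |(γ t).re| ≤ M := by
  obtain ⟨M, hM⟩ := (isCompact_Icc (a := -R) (b := R)).exists_bound_of_continuousOn
    (f := fun t => (γ t).re) (by fun_prop)
  refine ⟨max M |c|, fun t => ?_⟩
  rcases le_total R |t| with h | h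
  · rw [hc t h]; simp
  · exact (hM t (abs_le.1 h)).trans (le_max_left _ _)

/-- The real part of `γ` is bounded, so a sufficiently large real point has the whole path on its
left. Its index is carried back to `z` along the joining path. -/
theorem hasSideIndex_one_of_joinedIn (hγ : ContDiff ℝ 1 γ) {c R : ℝ}
    (hc : ∀ t : ℝ, R ≤ |t| → γ t = c + t * I) {z : ℂ}
    (hz : ∀ᶠ r : ℝ in atTop, JoinedIn (Set.range γ)ᶜ z r) : HasSideIndex γ c z 1 := by
  obtain ⟨M, hM⟩ := exists_bound_re hγ.continuous hc
  obtain ⟨r, hr, hrM⟩ := (hz.and (eventually_gt_atTop M)).exists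
  refine (hasSideIndex_one_of_re_neg hγ hc fun t => ?_).of_joinedIn hγ hc hr
  have := (le_abs_self _).trans (hM t)
  simp; linarith

theorem hasSideIndex_zero_of_joinedIn (hγ : ContDiff ℝ 1 γ) {c R : ℝ}
    (hc : ∀ t : ℝ, R ≤ |t| → γ t = c + t * I) {z : ℂ}
    (hz : ∀ᶠ r : ℝ in atBot, JoinedIn (Set.range γ)ᶜ z r) : HasSideIndex γ c z 0 := by
  obtain ⟨M, hM⟩ := exists_bound_re hγ.continuous hc
  obtain ⟨r, hr, hrM⟩ := (hz.and (eventually_lt_atBot (-M))).exists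
  refine (hasSideIndex_zero_of_re_pos hγ hc fun t => ?_).of_joinedIn hγ hc hr
  have := (abs_le.1 (hM t)).1
  simp; linarith

end Path

/-! ### Primitives modulo residues, and comparison of contours. -/

theorem AnalyticAt.dslope_self {f : ℂ → ℂ} {s : ℂ} (hf : AnalyticAt ℂ f s) :
    AnalyticAt ℂ (dslope f s) s := by
  obtain ⟨p, hp⟩ := hf
  exact ⟨_, hp.has_fpower_series_dslope_fslope⟩

theorem div_sub_sq_eq_dslope (f : ℂ → ℂ) {s z : ℂ} (hz : z ≠ s) :
    f z / (z - s) ^ 2 =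
      dslope (dslope f s) s z + (f s / (z - s) ^ 2 + deriv f s / (z - s)) := by
  have h : z - s ≠ 0 := sub_ne_zero.2 hz
  rw [dslope_of_ne _ hz, slope_def_field, dslope_same, dslope_of_ne _ hz, slope_def_field]
  field_simp
  ring

/-- A function on a convex open set with finitely many poles, of order at most two, has a primitive
after subtraction of the simple pole parts. -/
theorem exists_primitive_sub_residues {U : Set ℂ} (hU : IsOpen U) (hconv : Convex ℝ U)
    {F : ℂ → ℂ} {S : Finset ℂ} {G : ℂ → ℂ → ℂ} (hF : DifferentiableOn ℂ F (U \ S))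
    (hG : ∀ s ∈ S, AnalyticAt ℂ (G s) s)
    (hFG : ∀ s ∈ S, ∀ᶠ z in 𝓝[≠] s, F z = G s z / (z - s) ^ 2) :
    ∃ B : ℂ → ℂ, ∀ u ∈ U \ S, HasDerivAt B (F u - ∑ s ∈ S, deriv (G s) s / (u - s)) u := by
  classical
  set Q : ℂ → ℂ → ℂ := fun s u => G s s / (u - s) ^ 2 + deriv (G s) s / (u - s) with hQ
  have hQd : ∀ s u, u ≠ s → DifferentiableAt ℂ (Q s) u := by
    intro s u hu
    have h : u - s ≠ 0 := sub_ne_zero.2 hu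
    exact ((differentiableAt_const _).div ((differentiableAt_id.sub_const s).pow 2) (pow_ne_zero 2 h)).add
      ((differentiableAt_const _).div (differentiableAt_id.sub_const s) h)
  -- `h` is `F` without its principal parts, with the removable singularities filled in. At a pole
  -- `u` the term `Q u u` is `0` by the convention for division by zero, so the prescribed value is
  -- the right one.
  set h : ℂ → ℂ := fun u => (if u ∈ S then dslope (dslope (G u) u) u u else F u) - ∑ s ∈ S, Q s u
    with hh
  have hSc : IsClosed (S : Set ℂ) := S.finite_toSet.isClosed
  have hd : DifferentiableOn ℂ h U := by
    intro u hu
    apply DifferentiableAt.differentiableWithinAt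
    by_cases huS : u ∈ S
    · have hg : DifferentiableAt ℂ
          (fun z => dslope (dslope (G u) u) u z - ∑ s ∈ S.erase u, Q s z) u := by
        refine (hG u huS).dslope_self.dslope_self.differentiableAt.sub ?_
        refine DifferentiableAt.fun_sum fun s hs => hQd s u ?_
        exact fun h => (Finset.mem_erase.1 hs).1 h.symm
      refine hg.congr_of_eventuallyEq ?_
      have h1 : ∀ᶠ z in 𝓝 u, z ∉ S.erase u :=
        (S.erase u).finite_toSet.isClosed.isOpen_compl.mem_nhds (by simp)
      filter_upwards [h1, eventually_nhdsWithin_iff.1 (hFG u huS)] with z hz1 hz2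
      rw [hh]
      simp only
      rw [← Finset.add_sum_erase S _ huS]
      by_cases hzu : z = u
      · subst hzu
        simp [huS, hQ]
      · have hzS : z ∉ S := fun h => hz1 (Finset.mem_erase.2 ⟨hzu, h⟩)
        rw [if_neg hzS, hz2 hzu, div_sub_sq_eq_dslope _ hzu, hQ]
        ring
    · have hopen : IsOpen (U \ S) := hU.sdiff hSc
      have hg : DifferentiableAt ℂ (fun z => F z - ∑ s ∈ S, Q s z) u :=
        (hF.differentiableAt (hopen.mem_nhds ⟨hu, huS⟩)).sub
          (DifferentiableAt.fun_sum fun s hs => hQd s u fun h => huS (h ▸ hs))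
      refine hg.congr_of_eventuallyEq ?_
      filter_upwards [hopen.mem_nhds ⟨hu, huS⟩] with z hz
      simp only [hh, if_neg (show z ∉ S from hz.2)]
  obtain ⟨H, hH⟩ := hconv.exists_forall_hasDerivWithinAt hd
  -- The double pole parts have single-valued primitives and are put back; only the simple pole
  -- parts, with residue `deriv (G s) s`, stay out.
  refine ⟨fun u => H u + ∑ s ∈ S, -(G s s) / (u - s), fun u hu => ?_⟩
  have h1 := (hH u hu.1).hasDerivAt (hU.mem_nhds hu.1)
  have h2 : HasDerivAt (fun u => ∑ s ∈ S, -(G s s) / (u - s))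
      (∑ s ∈ S, G s s / (u - s) ^ 2) u := by
    refine HasDerivAt.fun_sum fun s hs => ?_
    have hne : u - s ≠ 0 := sub_ne_zero.2 fun h => hu.2 (h ▸ hs)
    refine ((hasDerivAt_const u (-(G s s))).div ((hasDerivAt_id u).sub_const s) hne).congr_deriv ?_
    simp
  refine (h1.add h2).congr_deriv ?_
  simp only [hh, hQ, if_neg (show u ∉ S from hu.2), Finset.sum_add_distrib]
  ring

section Comparison

variable {F : ℂ → ℂ} {S : Finset ℂ} {M : ℝ}

theorem integral_comp_mul_deriv_eq_of_primitive {U : Set ℂ} {r : ℂ → ℂ} (hF : ContinuousOn F (U \ S))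
    {B : ℂ → ℂ} (hB : ∀ u ∈ U \ S, HasDerivAt B (F u - ∑ s ∈ S, r s / (u - s)) u)
    {γ : ℝ → ℂ} (hγ : ContDiff ℝ 1 γ) (hγU : ∀ t, γ t ∈ U \ S) (a b : ℝ) :
    ∫ t in a..b, F (γ t) * deriv γ t =
      B (γ b) - B (γ a) + ∑ s ∈ S, r s * ∫ t in a..b, deriv γ t / (γ t - s) := by
  have hcd := continuous_deriv_of_contDiff_one hγ
  have hc1 : Continuous fun t => F (γ t) * deriv γ t :=
    (hF.comp_continuous hγ.continuous hγU).mul hcd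
  have hc2 : ∀ s ∈ S, Continuous fun t => r s * (deriv γ t / (γ t - s)) := fun s hs =>
    continuous_const.mul (continuous_deriv_div_sub hγ (by
      rintro ⟨t, rfl⟩
      exact (hγU t).2 hs))
  have hc3 : Continuous fun t => ∑ s ∈ S, r s * (deriv γ t / (γ t - s)) :=
    continuous_finsetSum S hc2
  have h := intervalIntegral.integral_eq_sub_of_hasDerivAt (a := a) (b := b)
    (f := fun t => B (γ t))
    (f' := fun t => F (γ t) * deriv γ t - ∑ s ∈ S, r s * (deriv γ t / (γ t - s)))
    (fun t _ => by
      refine ((hB _ (hγU t)).comp_of_eq t (hasDerivAt_of_contDiff_one hγ t) rfl).congr_deriv ?_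
      rw [sub_mul, Finset.sum_mul]
      congr 1
      exact Finset.sum_congr rfl fun s _ => by ring)
    ((hc1.sub hc3).intervalIntegrable _ _)
  rw [intervalIntegral.integral_sub (hc1.intervalIntegrable _ _) (hc3.intervalIntegrable _ _),
    intervalIntegral.integral_finsetSum (fun s hs => (hc2 s hs).intervalIntegrable _ _)] at h
  simp only [intervalIntegral.integral_const_mul] at h
  rw [← h]; ring

/-- Two integrals along paths with vertical ends, in a strip where the integrand has finitely many
poles of order at most two, differ by the residues at the poles which they do not have on the same
side. -/
theorem integral_sub_integral_eq_sum_residues {G : ℂ → ℂ → ℂ} {K : ℝ}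
    (hSim : ∀ s ∈ S, s.im = 0)
    (hF : DifferentiableOn ℂ F ({u | |u.re| < M} \ S))
    (hG : ∀ s ∈ S, AnalyticAt ℂ (G s) s)
    (hFG : ∀ s ∈ S, ∀ᶠ z in 𝓝[≠] s, F z = G s z / (z - s) ^ 2)
    (hK : ∀ u : ℂ, |u.re| < M → 1 ≤ |u.im| → ‖F u‖ ≤ K / |u.im|)
    {γ₁ γ₂ : ℝ → ℂ} (hγ₁ : ContDiff ℝ 1 γ₁) (hγ₂ : ContDiff ℝ 1 γ₂) {c₁ R₁ c₂ R₂ : ℝ}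
    (hc₁ : ∀ t : ℝ, R₁ ≤ |t| → γ₁ t = c₁ + t * I) (hc₂ : ∀ t : ℝ, R₂ ≤ |t| → γ₂ t = c₂ + t * I)
    (hM₁ : ∀ t, |(γ₁ t).re| < M) (hM₂ : ∀ t, |(γ₂ t).re| < M)
    (hS₁ : ∀ t, γ₁ t ∉ S) (hS₂ : ∀ t, γ₂ t ∉ S) {e₁ e₂ : ℂ → ℂ}
    (he₁ : ∀ s ∈ S, HasSideIndex γ₁ c₁ s (e₁ s)) (he₂ : ∀ s ∈ S, HasSideIndex γ₂ c₂ s (e₂ s))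
    (hi₁ : Integrable fun t => F (γ₁ t) * deriv γ₁ t)
    (hi₂ : Integrable fun t => F (γ₂ t) * deriv γ₂ t) :
    (∫ t, F (γ₁ t) * deriv γ₁ t) - ∫ t, F (γ₂ t) * deriv γ₂ t =
      2 * Real.pi * I * ∑ s ∈ S, (e₂ s - e₁ s) * deriv (G s) s := by
  have hUo : IsOpen {u : ℂ | |u.re| < M} := isOpen_lt (by fun_prop) continuous_const
  have hUc : Convex ℝ {u : ℂ | |u.re| < M} := by
    have : {u : ℂ | |u.re| < M} = reLm ⁻¹' Set.Ioo (-M) M := by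
      ext u; simp [abs_lt]
    rw [this]
    exact (convex_Ioo _ _).linear_preimage _
  obtain ⟨B, hB⟩ := exists_primitive_sub_residues hUo hUc hF hG hFG
  -- As the poles are real, `P` is a primitive of `F` in each half of the strip off the real axis.
  -- The jump across the axis is accounted for by the side indices.
  set P : ℂ → ℂ := fun u => B u + ∑ s ∈ S, deriv (G s) s * log (u - s) with hP
  have hPd : ∀ u : ℂ, |u.re| < M → u.im ≠ 0 → HasDerivAt P (F u) u := by
    intro u hu hu0
    have hne : ∀ s ∈ S, (u - s).im ≠ 0 := fun s hs => by simpa [hSim s hs] using hu0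
    have h1 := hB u ⟨hu, fun h => hu0 (hSim u h)⟩
    have h2 : HasDerivAt (fun u => ∑ s ∈ S, deriv (G s) s * log (u - s))
        (∑ s ∈ S, deriv (G s) s / (u - s)) u := by
      refine HasDerivAt.fun_sum fun s hs => ?_
      refine ((((hasDerivAt_id u).sub_const s).clog (Or.inr (hne s hs))).const_mul _).congr_deriv ?_
      simp only [id]
      ring
    exact (h1.add h2).congr_deriv (by ring)
  have hpath : ∀ {γ : ℝ → ℂ} {c R : ℝ} {e : ℂ → ℂ}, ContDiff ℝ 1 γ →
      (∀ t : ℝ, R ≤ |t| → γ t = c + t * I) → (∀ t, |(γ t).re| < M) → (∀ t, γ t ∉ S) →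
      (∀ s ∈ S, HasSideIndex γ c s (e s)) →
      ∀ᶠ T : ℝ in atTop, ∫ t in -T..T, F (γ t) * deriv γ t =
        P (c + T * I) - P (c - T * I) - 2 * Real.pi * I * ∑ s ∈ S, e s * deriv (G s) s := by
    intro γ c R e hγ hc hM hS he
    filter_upwards [(Finset.eventually_all S).2 he, eventually_ge_atTop R, eventually_ge_atTop 0]
      with T heT hT hT0
    rw [integral_comp_mul_deriv_eq_of_primitive hF.continuousOn hB hγ (fun t => ⟨hM t, hS t⟩),
      hc T (by rwa [abs_of_nonneg hT0]), hc (-T) (by rwa [abs_neg, abs_of_nonneg hT0]),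
      show (c : ℂ) + (-T : ℝ) * I = c - T * I by push_cast; ring,
      Finset.sum_congr rfl fun s hs => by rw [heT s hs]]
    simp only [hP, Finset.mul_sum]
    rw [add_sub_add_comm, ← Finset.sum_sub_distrib, add_sub_assoc, ← Finset.sum_sub_distrib]
    congr 1
    exact Finset.sum_congr rfl fun s _ => by ring
  have hcM : ∀ {γ : ℝ → ℂ} {c R : ℝ}, (∀ t : ℝ, R ≤ |t| → γ t = c + t * I) →
      (∀ t, |(γ t).re| < M) → |c| < M := by
    intro γ c R hc hM
    have := hM |R|
    rw [hc |R| (by rw [abs_abs]; exact le_abs_self R)] at this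
    simpa using this
  -- The horizontal segments joining the two vertical ends contribute nothing in the limit.
  have hhor : ∀ τ : ℝ, 1 ≤ |τ| → ‖P (c₁ + τ * I) - P (c₂ + τ * I)‖ ≤ K / |τ| * |c₁ - c₂| := by
    intro τ hτ
    have hconv : Convex ℝ ({u : ℂ | |u.re| < M} ∩ {u | u.im = τ}) := by
      refine hUc.inter ?_
      have : {u : ℂ | u.im = τ} = imLm ⁻¹' {τ} := by ext; simp
      rw [this]
      exact (convex_singleton τ).linear_preimage _
    have h := hconv.norm_image_sub_le_of_norm_hasDerivWithin_le (f := P) (f' := F) (C := K / |τ|)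
      (x := c₂ + τ * I) (y := c₁ + τ * I)
      (fun u hu => (hPd u hu.1 (by
        rw [hu.2]; exact abs_pos.1 (by linarith))).hasDerivWithinAt)
      (fun u hu => by have := hK u hu.1 (by rwa [hu.2]); rwa [hu.2] at this)
      ⟨by simpa using hcM hc₂ hM₂, by simp⟩ ⟨by simpa using hcM hc₁ hM₁, by simp⟩
    have e : (c₁ : ℂ) + τ * I - (c₂ + τ * I) = ((c₁ - c₂ : ℝ) : ℂ) := by push_cast; ring
    rwa [e, norm_real, Real.norm_eq_abs] at h
  have hlim : ∀ {γ : ℝ → ℂ}, Integrable (fun t => F (γ t) * deriv γ t) →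
      Tendsto (fun T : ℝ => ∫ t in -T..T, F (γ t) * deriv γ t) atTop
        (𝓝 (∫ t, F (γ t) * deriv γ t)) := fun hi =>
    intervalIntegral_tendsto_integral hi tendsto_neg_atTop_atBot tendsto_id
  refine tendsto_nhds_unique ((hlim hi₁).sub (hlim hi₂)) ?_
  rw [tendsto_iff_norm_sub_tendsto_zero]
  have hz : Tendsto (fun T : ℝ => 2 * (K / T * |c₁ - c₂|)) atTop (𝓝 0) := by
    have : Tendsto (fun T : ℝ => K / T) atTop (𝓝 0) := tendsto_const_nhds.div_atTop tendsto_id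
    simpa using (this.mul_const |c₁ - c₂|).const_mul 2
  refine squeeze_zero' (Eventually.of_forall fun _ => norm_nonneg _) ?_ hz
  filter_upwards [hpath hγ₁ hc₁ hM₁ hS₁ he₁, hpath hγ₂ hc₂ hM₂ hS₂ he₂, eventually_ge_atTop 1]
    with T h1 h2 hT
  have hTa : |T| = T := abs_of_pos (by linarith)
  have h3 := hhor T (by rwa [hTa])
  have h4 := hhor (-T) (by rwa [abs_neg, hTa])
  rw [abs_neg, hTa] at h4
  rw [hTa] at h3
  rw [h1, h2]
  simp only [sub_mul, Finset.sum_sub_distrib]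
  calc _ = ‖(P (c₁ + T * I) - P (c₂ + T * I)) - (P (c₁ + (-T : ℝ) * I) - P (c₂ + (-T : ℝ) * I))‖ := by
        congr 1
        push_cast
        simp only [neg_mul, ← sub_eq_add_neg]
        ring
    _ ≤ _ := (norm_sub_le _ _).trans (by linarith)

end Comparison

/-! ### The squared cosecant: local form at the integers and decay. -/

/-- The function `(π / sin (π u)) ^ 2`, which is `(Γ(-u) Γ(1 + u)) ^ 2`. -/
def cscSq (u : ℂ) : ℂ := (Real.pi / sin (Real.pi * u)) ^ 2

/-- The entire function `sin (π z) / z`. -/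
def sinQuot : ℂ → ℂ := dslope (fun z => sin (Real.pi * z)) 0

theorem sin_pi_mul_eq (z : ℂ) : sin (Real.pi * z) = z * sinQuot z := by
  have := sub_smul_dslope (fun z : ℂ => sin (Real.pi * z)) 0 z
  simpa [sinQuot] using this.symm

theorem hasDerivAt_sin_pi_mul (z : ℂ) :
    HasDerivAt (fun z : ℂ => sin (Real.pi * z)) (Real.pi * cos (Real.pi * z)) z := by
  simpa [mul_comm] using ((hasDerivAt_id z).const_mul (Real.pi : ℂ)).csin

theorem sinQuot_zero : sinQuot 0 = Real.pi := by
  rw [sinQuot, dslope_same, (hasDerivAt_sin_pi_mul 0).deriv]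
  simp

theorem analyticAt_sinQuot_zero : AnalyticAt ℂ sinQuot 0 := by
  refine AnalyticAt.dslope_self ?_
  refine DifferentiableOn.analyticAt (s := Set.univ) (fun z _ => ?_) univ_mem
  exact (hasDerivAt_sin_pi_mul z).differentiableAt.differentiableWithinAt

theorem sinQuot_neg (z : ℂ) : sinQuot (-z) = sinQuot z := by
  rcases eq_or_ne z 0 with rfl | hz
  · simp
  have h1 := sin_pi_mul_eq (-z)
  rw [mul_neg, sin_neg, sin_pi_mul_eq z] at h1
  exact mul_left_cancel₀ hz (by linear_combination h1)

/-- By evenness. Hence the squared cosecant has no residue at `0`, and multiplication by `x ^ u`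
creates exactly the residue `log x`. -/
theorem deriv_sinQuot_zero : deriv sinQuot 0 = 0 := by
  have h := deriv_comp_neg sinQuot 0
  simp only [sinQuot_neg, neg_zero] at h
  have h2 : (2 : ℂ) * deriv sinQuot 0 = 0 := by linear_combination h
  simpa using h2

theorem sin_pi_mul_sub_int_sq (z : ℂ) (n : ℤ) :
    sin (Real.pi * (z - n)) ^ 2 = sin (Real.pi * z) ^ 2 := by
  rw [mul_sub, mul_comm (Real.pi : ℂ) n, sin_antiperiodic.sub_int_mul_eq, mul_pow]
  rcases Int.even_or_odd n with h | h
  · simp [Int.negOnePow_even n h]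
  · simp [Int.negOnePow_odd n h]

/-- This exhibits the double pole at `n`. It holds even at `z = n`, where both sides are `0` by
convention. -/
theorem cscSq_eq_div (z : ℂ) (n : ℤ) :
    cscSq z = Real.pi ^ 2 / sinQuot (z - n) ^ 2 / (z - n) ^ 2 := by
  rw [cscSq, div_pow, ← sin_pi_mul_sub_int_sq z n, sin_pi_mul_eq, mul_pow, div_div, mul_comm]

theorem cscSq_add_one (u : ℂ) : cscSq (u + 1) = cscSq u := by
  rw [cscSq, cscSq, div_pow, div_pow, ← sin_pi_mul_sub_int_sq (u + 1) 1]
  simp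

theorem analyticAt_pi_sq_div_sinQuot (n : ℤ) :
    AnalyticAt ℂ (fun z => Real.pi ^ 2 / sinQuot (z - n) ^ 2) n := by
  have h : AnalyticAt ℂ (fun z => sinQuot (z - n)) n :=
    AnalyticAt.fun_comp_of_eq (x := (n : ℂ)) (f := fun z : ℂ => z - n) analyticAt_sinQuot_zero
      (by fun_prop) (by simp)
  refine analyticAt_const.div (h.pow 2) ?_
  simp [sinQuot_zero]

theorem differentiableAt_cscSq {u : ℂ} (hu : ∀ n : ℤ, u ≠ n) : DifferentiableAt ℂ cscSq u :=
  ((differentiableAt_const _).div (hasDerivAt_sin_pi_mul u).differentiableAt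
    (sin_pi_mul_ne_zero fun ⟨n, hn⟩ => hu n hn.symm)).pow 2

/-- Because `|sin (p + iq)|² = sin² p + sinh² q`. -/
theorem abs_sinh_im_le_norm_sin (z : ℂ) : |Real.sinh z.im| ≤ ‖sin z‖ := by
  rw [← Real.sqrt_sq_eq_abs, Complex.norm_def]
  apply Real.sqrt_le_sqrt
  have h : sin z = ((Real.sin z.re * Real.cosh z.im : ℝ) : ℂ) +
      ((Real.cos z.re * Real.sinh z.im : ℝ) : ℂ) * I := by
    conv_lhs => rw [sin_eq z]
    push_cast; ring
  rw [h, normSq_add_mul_I]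
  nlinarith [Real.cosh_sq z.im, Real.sin_sq_add_cos_sq z.re, sq_nonneg (Real.sin z.re)]

theorem norm_cscSq_le {u : ℂ} (hu : u.im ≠ 0) : ‖cscSq u‖ ≤ 1 / u.im ^ 2 := by
  have h1 : Real.pi * |u.im| ≤ ‖sin (Real.pi * u)‖ := by
    refine le_trans ?_ (abs_sinh_im_le_norm_sin _)
    have : ((Real.pi : ℂ) * u).im = Real.pi * u.im := by simp
    rw [this, Real.abs_sinh, abs_mul, abs_of_pos Real.pi_pos]
    exact Real.self_le_sinh_iff.2 (by positivity)
  have h2 : 0 < |u.im| := abs_pos.2 hu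
  rw [cscSq, norm_pow, norm_div, norm_real, Real.norm_of_nonneg Real.pi_pos.le, ← sq_abs u.im,
    ← one_div_pow]
  refine pow_le_pow_left₀ (by positivity) ?_ 2
  rw [div_le_div_iff₀ (lt_of_lt_of_le (by positivity) h1) h2]
  linarith

/-! ### Bounds in vertical strips and integrability. -/

theorem norm_cpow_le_of_abs_re_le {x M : ℝ} (hx : 0 < x) {u : ℂ} (hu : |u.re| ≤ M) :
    ‖(x : ℂ) ^ u‖ ≤ x ^ M + x ^ (-M) := by
  rw [norm_cpow_eq_rpow_re_of_pos hx]
  have hu' := abs_le.1 hu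
  rcases le_total 1 x with h | h
  · have := Real.rpow_le_rpow_of_exponent_le h hu'.2
    have := Real.rpow_nonneg hx.le (-M)
    linarith
  · have := Real.rpow_le_rpow_of_exponent_ge hx h hu'.1
    have := Real.rpow_nonneg hx.le M
    linarith

theorem integrable_of_continuous_of_le_div_sq {g : ℝ → ℂ} (hg : Continuous g) {R C : ℝ}
    (h : ∀ t, R ≤ |t| → ‖g t‖ ≤ C / t ^ 2) : Integrable g := by
  obtain ⟨D, hD⟩ := (isCompact_Icc (a := -(max R 1)) (b := max R 1)).exists_bound_of_continuousOn
    hg.continuousOn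
  refine (integrable_inv_one_add_sq.const_mul (max (D * (1 + (max R 1) ^ 2)) (2 * |C|))).mono'
    hg.aestronglyMeasurable (Eventually.of_forall fun t => ?_)
  have hp : 0 < 1 + t ^ 2 := by positivity
  rw [← div_eq_mul_inv, le_div_iff₀ hp]
  rcases le_total |t| (max R 1) with ht | ht
  · refine le_max_of_le_left ?_
    have h1 := hD t (abs_le.1 ht)
    have h2 : t ^ 2 ≤ (max R 1) ^ 2 := by
      rw [← sq_abs t]; gcongr
    have h3 := norm_nonneg (g t)
    gcongr
    exact h3.trans h1
  · refine le_max_of_le_right ?_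
    have h1 := h t ((le_max_left _ _).trans ht)
    have h2 : 1 ≤ |t| := (le_max_right _ _).trans ht
    have h3 : 1 ≤ t ^ 2 := by rw [← sq_abs]; nlinarith
    calc ‖g t‖ * (1 + t ^ 2) ≤ |C| / t ^ 2 * (2 * t ^ 2) := by
          gcongr
          · exact h1.trans (by gcongr; exact le_abs_self C)
          · linarith
      _ = 2 * |C| := by
          have : t ≠ 0 := by rintro rfl; norm_num at h2
          field_simp

theorem contDiff_vertical_line (c : ℝ) : ContDiff ℝ 1 fun t : ℝ => (c : ℂ) + t * I :=
  contDiff_const.add (ofRealCLM.contDiff.mul contDiff_const)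

theorem deriv_vertical_line (c t : ℝ) : deriv (fun t : ℝ => (c : ℂ) + t * I) t = I := by
  simpa using ((ofRealCLM.hasDerivAt (x := t)).mul_const I).const_add (c : ℂ) |>.deriv

theorem integrable_mul_deriv_of_le {F : ℂ → ℂ} {M K : ℝ}
    (hK : ∀ u : ℂ, |u.re| < M → 1 ≤ |u.im| → ‖F u‖ ≤ K / u.im ^ 2)
    {γ : ℝ → ℂ} (hγ : ContDiff ℝ 1 γ) {c R : ℝ} (hc : ∀ t : ℝ, R ≤ |t| → γ t = c + t * I)
    (hM : ∀ t, |(γ t).re| < M) (hF : ∀ t, ContinuousAt F (γ t)) :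
    Integrable fun t => F (γ t) * deriv γ t := by
  have hcont : Continuous fun t => F (γ t) :=
    continuous_iff_continuousAt.2 fun t => (hF t).comp hγ.continuous.continuousAt
  refine integrable_of_continuous_of_le_div_sq (hcont.mul (continuous_deriv_of_contDiff_one hγ))
    -- The extra `1` makes `R < |t|` strict, so `γ` is the vertical line in a neighbourhood of `t`
    -- and its derivative there is `I`.
    (R := max (R + 1) 1) (C := K) fun t ht => ?_
  have hR : R < |t| := by linarith [(le_max_left _ _).trans ht]
  have h1 : 1 ≤ |t| := (le_max_right _ _).trans ht
  have hd : deriv γ t = I := by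
    have : γ =ᶠ[𝓝 t] fun t : ℝ => (c : ℂ) + t * I := by
      filter_upwards [(isOpen_lt continuous_const continuous_abs).mem_nhds hR] with τ hτ
      exact hc τ (le_of_lt hτ)
    rw [this.deriv_eq, deriv_vertical_line]
  have him : (γ t).im = t := by rw [hc t hR.le]; simp
  have := hK (γ t) (hM t) (by rwa [him])
  rw [him] at this
  simpa [hd] using this

theorem hasSideIndex_vertical_line (c : ℝ) {s : ℂ} (hs : s.re ≠ c) :
    HasSideIndex (fun t : ℝ => (c : ℂ) + t * I) c s (if c < s.re then 1 else 0) := by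
  split_ifs with h
  · exact hasSideIndex_one_of_re_neg (R := 0) (contDiff_vertical_line c) (fun _ _ => rfl)
      (by intro t; simpa using h)
  · refine hasSideIndex_zero_of_re_pos (R := 0) (contDiff_vertical_line c) (fun _ _ => rfl) ?_
    intro t
    simpa using lt_of_le_of_ne (not_lt.1 h) hs

theorem norm_cscSq_mul_cpow_le {x M : ℝ} (hx : 0 < x) {u : ℂ} (hu : |u.re| < M)
    (hu1 : 1 ≤ |u.im|) : ‖cscSq u * (x : ℂ) ^ u‖ ≤ (x ^ M + x ^ (-M)) / u.im ^ 2 := by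
  have h0 : u.im ≠ 0 := abs_pos.1 (by linarith)
  rw [norm_mul, div_eq_mul_one_div, mul_comm]
  gcongr
  · exact norm_cpow_le_of_abs_re_le hx hu.le
  · exact norm_cscSq_le h0

theorem div_sq_le_div_abs {K y : ℝ} (hK : 0 ≤ K) (hy : 1 ≤ |y|) : K / y ^ 2 ≤ K / |y| := by
  rw [← sq_abs]
  gcongr
  nlinarith

theorem hasDerivAt_const_cpow {x : ℝ} (hx : 0 < x) (u : ℂ) :
    HasDerivAt (fun u : ℂ => (x : ℂ) ^ u) ((x : ℂ) ^ u * Real.log x) u := by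
  have := (hasDerivAt_id u).const_cpow (c := (x : ℂ)) (Or.inl (by exact_mod_cast hx.ne'))
  simpa [ofReal_log hx.le] using this

theorem analyticAt_const_cpow {x : ℝ} (hx : 0 < x) (u : ℂ) :
    AnalyticAt ℂ (fun u : ℂ => (x : ℂ) ^ u) u :=
  DifferentiableOn.analyticAt (s := Set.univ)
    (fun z _ => (hasDerivAt_const_cpow hx z).differentiableAt.differentiableWithinAt) univ_mem

theorem ne_intCast_of_re {u : ℂ} (n : ℤ) (h1 : (n : ℝ) < u.re) (h2 : u.re < n + 1) (m : ℤ) :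
    u ≠ m := by
  rintro rfl
  simp only [intCast_re] at h1 h2
  have : n < m := by exact_mod_cast h1
  have : m < n + 1 := by exact_mod_cast h2
  omega

/-! ### The shift relation for the line integral. -/

/-- The line integral `∫ (π / sin πu)² x ^ u` is determined by its shift across the pole `u = 0`. -/
theorem sub_one_mul_integral_cscSq_mul_cpow {x : ℝ} (hx : 0 < x) :
    ((x : ℂ) - 1) * ∫ t : ℝ, cscSq ((-1 / 4 : ℝ) + t * I) * (x : ℂ) ^ (((-1 / 4 : ℝ) : ℂ) + t * I) =
      2 * Real.pi * Real.log x := by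
  set F : ℂ → ℂ := fun u => cscSq u * (x : ℂ) ^ u with hF
  set G : ℂ → ℂ := fun z => Real.pi ^ 2 / sinQuot z ^ 2 * (x : ℂ) ^ z with hG
  have hGa : AnalyticAt ℂ G 0 := by
    have := analyticAt_pi_sq_div_sinQuot 0
    simp only [Int.cast_zero, sub_zero] at this
    exact this.mul (analyticAt_const_cpow hx 0)
  have hGd : deriv G 0 = Real.log x := by
    have h1 : HasDerivAt sinQuot 0 0 := by
      simpa [deriv_sinQuot_zero] using analyticAt_sinQuot_zero.differentiableAt.hasDerivAt
    have hpi : (Real.pi : ℂ) ≠ 0 := ofReal_ne_zero.2 Real.pi_ne_zero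
    have h2 := ((hasDerivAt_const (0 : ℂ) ((Real.pi : ℂ) ^ 2)).div (h1.pow 2)
      (by simp [sinQuot_zero])).mul (hasDerivAt_const_cpow hx 0)
    refine h2.deriv.trans ?_
    simp [sinQuot_zero]
  have hdiff : ∀ u : ℂ, (∀ n : ℤ, u ≠ n) → DifferentiableAt ℂ F u := fun u hu =>
    (differentiableAt_cscSq hu).mul (hasDerivAt_const_cpow hx u).differentiableAt
  have hline : ∀ c : ℝ, |c| < 7 / 8 → (∀ t : ℝ, ∀ n : ℤ, (c : ℂ) + t * I ≠ n) →
      Integrable fun t : ℝ => F (c + t * I) * deriv (fun t : ℝ => (c : ℂ) + t * I) t := by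
    intro c hc hn
    exact integrable_mul_deriv_of_le (M := 7 / 8) (R := 0)
      (fun u hu hu1 => norm_cscSq_mul_cpow_le hx hu hu1)
      (contDiff_vertical_line c) (fun _ _ => rfl) (by simpa using hc)
      (fun t => (hdiff _ (hn t)).continuousAt)
  have hn1 : ∀ t : ℝ, ∀ n : ℤ, (((-1 / 4 : ℝ) : ℂ) + t * I) ≠ n := fun t =>
    ne_intCast_of_re (-1) (by simp; norm_num) (by simp; norm_num)
  have hn2 : ∀ t : ℝ, ∀ n : ℤ, (((3 / 4 : ℝ) : ℂ) + t * I) ≠ n := fun t =>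
    ne_intCast_of_re 0 (by simp) (by simp; norm_num)
  -- The strip `|Re u| < 7/8` contains the lines `Re = -1/4` and `Re = 3/4`, but no integer other
  -- than `0`.
  have key := integral_sub_integral_eq_sum_residues (F := F) (S := {0}) (M := 7 / 8)
    (G := fun _ => G) (K := x ^ (7 / 8 : ℝ) + x ^ (-(7 / 8) : ℝ)) (by simp)
    (by
      intro u hu
      refine (hdiff u fun n hn => hu.2 ?_).differentiableWithinAt
      have h := hu.1
      simp only [hn, intCast_re, Set.mem_ofPred_eq] at h
      have h' : |n| < 1 := by
        have : (|n| : ℝ) < 1 := by linarith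
        exact_mod_cast this
      have h0 : n = 0 := Int.abs_lt_one_iff.1 h'
      simp [hn, h0])
    (by simpa using hGa)
    (by
      intro s hs
      rw [Finset.mem_singleton] at hs
      subst hs
      refine Eventually.of_forall fun z => ?_
      simp only [hF, hG, cscSq_eq_div z 0]
      simp only [Int.cast_zero, sub_zero]
      ring)
    (fun u hu hu1 => (norm_cscSq_mul_cpow_le hx hu hu1).trans
      (div_sq_le_div_abs (by positivity) hu1))
    (contDiff_vertical_line (3 / 4)) (contDiff_vertical_line (-1 / 4)) (R₁ := 0) (R₂ := 0)
    (fun _ _ => rfl) (fun _ _ => rfl)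
    (by intro t; simp; norm_num [abs_lt]) (by intro t; simp; norm_num [abs_lt])
    (by intro t; simpa using hn2 t 0) (by intro t; simpa using hn1 t 0)
    (fun s hs => hasSideIndex_vertical_line _ (by rw [Finset.mem_singleton.1 hs]; norm_num))
    (fun s hs => hasSideIndex_vertical_line _ (by rw [Finset.mem_singleton.1 hs]; norm_num))
    (hline _ (by norm_num [abs_lt]) hn2) (hline _ (by norm_num [abs_lt]) hn1)
  simp only [deriv_vertical_line, Finset.sum_singleton, hGd, zero_re] at key
  rw [integral_mul_const, integral_mul_const] at key
  have hshift : ∀ t : ℝ, F ((3 / 4 : ℝ) + t * I) = x * F ((-1 / 4 : ℝ) + t * I) := by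
    intro t
    have hx0 : (x : ℂ) ≠ 0 := by exact_mod_cast hx.ne'
    simp only [hF]
    rw [show (((3 / 4 : ℝ) : ℂ) + t * I) = (((-1 / 4 : ℝ) : ℂ) + t * I) + 1 by push_cast; ring,
      cscSq_add_one, cpow_add _ _ hx0, cpow_one]
    ring
  simp only [hshift] at key
  rw [integral_const_mul] at key
  rw [if_pos (by norm_num), if_neg (by norm_num)] at key
  exact mul_right_cancel₀ I_ne_zero (by linear_combination key)

/-! ### Independence of the path for the reduced integrand. -/

/-- The integrand of the Meijer function under consideration, for `a = 0`, where no Gamma factor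
has a pole. -/
def reducedIntegrand (x : ℝ) (u : ℂ) : ℂ := cscSq u * (x : ℂ) ^ u / (u + 1 / 2)

theorem differentiableAt_reducedIntegrand {x : ℝ} (hx : 0 < x) {u : ℂ} (hu : ∀ n : ℤ, u ≠ n)
    (hu' : u ≠ -1 / 2) : DifferentiableAt ℂ (reducedIntegrand x) u := by
  refine ((differentiableAt_cscSq hu).mul
    (hasDerivAt_const_cpow hx u).differentiableAt).div (by fun_prop) ?_
  exact fun h => hu' (by linear_combination h)

theorem norm_reducedIntegrand_le {x M : ℝ} (hx : 0 < x) {u : ℂ} (hu : |u.re| < M)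
    (hu1 : 1 ≤ |u.im|) : ‖reducedIntegrand x u‖ ≤ (x ^ M + x ^ (-M)) / u.im ^ 2 := by
  have h1 : 1 ≤ ‖u + 1 / 2‖ := by
    have := abs_im_le_norm (u + 1 / 2)
    simp at this
    simpa using hu1.trans this
  rw [reducedIntegrand, norm_div]
  exact (div_le_self (norm_nonneg _) h1).trans (norm_cscSq_mul_cpow_le hx hu hu1)

theorem ne_neg_half_of_re {u : ℂ} (hu : u.re ≠ -1 / 2) : u ≠ -1 / 2 := by
  rintro rfl
  simp at hu

/-- Every path that separates the poles at `0, 1, …` from those at `-1, -2, …` and `-1/2` gives the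
same integral as the line `Re = -1/4`. -/
theorem integral_reducedIntegrand {x : ℝ} (hx : 0 < x) {γ : ℝ → ℂ} (hγ : ContDiff ℝ 1 γ) {c R : ℝ}
    (hc : ∀ t : ℝ, R ≤ |t| → γ t = c + t * I) (hn : ∀ t, ∀ n : ℤ, γ t ≠ n)
    (hh : ∀ t, γ t ≠ -1 / 2) (hright : ∀ n : ℤ, 0 ≤ n → HasSideIndex γ c n 1)
    (hleft : ∀ n : ℤ, n < 0 → HasSideIndex γ c n 0) (hhalf : HasSideIndex γ c (-1 / 2) 0) :
    Integrable (fun t => reducedIntegrand x (γ t) * deriv γ t) ∧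
      ∫ t, reducedIntegrand x (γ t) * deriv γ t =
        I * ∫ t : ℝ, reducedIntegrand x ((-1 / 4 : ℝ) + t * I) := by
  classical
  obtain ⟨M', hM'⟩ := exists_bound_re hγ.continuous hc
  set M := max M' 1 + 1 with hM
  have hM1 : ∀ t, |(γ t).re| < M := fun t => by
    have := hM' t; have := le_max_left M' 1; linarith
  have hM2 : ∀ t : ℝ, |(((-1 / 4 : ℝ) : ℂ) + t * I).re| < M := fun t => by
    have := le_max_right M' 1
    simp only [add_re, ofReal_re, mul_re, I_re, mul_zero, ofReal_im, I_im, mul_one, sub_self,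
      add_zero]
    rw [abs_lt]; constructor <;> linarith
  have hn' : ∀ t : ℝ, ∀ n : ℤ, (((-1 / 4 : ℝ) : ℂ) + t * I) ≠ n := fun t =>
    ne_intCast_of_re (-1) (by simp; norm_num) (by simp; norm_num)
  have hh' : ∀ t : ℝ, (((-1 / 4 : ℝ) : ℂ) + t * I) ≠ -1 / 2 := fun t =>
    ne_neg_half_of_re (by simp; norm_num)
  have hint : ∀ {δ : ℝ → ℂ} {c R : ℝ}, ContDiff ℝ 1 δ → (∀ t : ℝ, R ≤ |t| → δ t = c + t * I) →
      (∀ t, |(δ t).re| < M) → (∀ t, ∀ n : ℤ, δ t ≠ n) → (∀ t, δ t ≠ -1 / 2) →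
      Integrable (fun t => reducedIntegrand x (δ t) * deriv δ t) := fun hδ hc hM hn hh =>
    integrable_mul_deriv_of_le (fun u hu hu1 => norm_reducedIntegrand_le hx hu hu1) hδ hc hM
      fun t => (differentiableAt_reducedIntegrand hx (hn t) (hh t)).continuousAt
  have hi := hint hγ hc hM1 hn hh
  refine ⟨hi, ?_⟩
  obtain ⟨N, hN⟩ := exists_nat_ge M
  set S : Finset ℂ := insert (-1 / 2) ((Finset.Icc (-(N : ℤ)) N).image ((↑) : ℤ → ℂ)) with hS
  have hSmem : ∀ s ∈ S, s = -1 / 2 ∨ ∃ n : ℤ, s = n := by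
    intro s hs
    rw [hS, Finset.mem_insert, Finset.mem_image] at hs
    rcases hs with h | ⟨n, -, h⟩
    · exact Or.inl h
    · exact Or.inr ⟨n, h.symm⟩
  have hnhalf : ∀ n : ℤ, (n : ℂ) ≠ -1 / 2 := by
    intro n
    refine (ne_intCast_of_re (u := -1 / 2) (-1) ?_ ?_ n).symm <;> norm_num
  have havoid : ∀ {δ : ℝ → ℂ}, (∀ t, ∀ n : ℤ, δ t ≠ n) → (∀ t, δ t ≠ -1 / 2) → ∀ t, δ t ∉ S := by
    intro δ hn hh t ht
    rcases hSmem _ ht with h | ⟨n, h⟩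
    · exact hh t h
    · exact hn t n h
  -- The simple pole at `-1/2` is written as a double one, with a numerator vanishing there. No
  -- residue has to be computed, since both paths have the same side indices.
  set G : ℂ → ℂ → ℂ := fun s z =>
    if s = -1 / 2 then cscSq z * (x : ℂ) ^ z * (z + 1 / 2)
    else Real.pi ^ 2 / sinQuot (z - s) ^ 2 * (x : ℂ) ^ z / (z + 1 / 2) with hG
  have key := integral_sub_integral_eq_sum_residues (F := reducedIntegrand x) (S := S) (M := M)
    (G := G) (K := x ^ M + x ^ (-M))
    (by
      intro s hs
      rcases hSmem _ hs with rfl | ⟨n, rfl⟩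
      · simp
      · simp)
    (by
      intro u hu
      refine (differentiableAt_reducedIntegrand hx (fun n h => ?_) fun h => ?_).differentiableWithinAt
      · have h1 := hu.1
        simp only [h, intCast_re, Set.mem_ofPred_eq] at h1
        have h2 : (|n| : ℤ) ≤ N := by
          have : (|(n : ℝ)|) ≤ N := (h1.trans_le hN).le
          exact_mod_cast this
        refine hu.2 ?_
        rw [h, hS, Finset.mem_coe, Finset.mem_insert, Finset.mem_image]
        exact Or.inr ⟨n, Finset.mem_Icc.2 (abs_le.1 h2), rfl⟩
      · refine hu.2 ?_
        rw [h, hS, Finset.mem_coe]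
        exact Finset.mem_insert_self _ _)
    (by
      intro s hs
      rcases hSmem _ hs with rfl | ⟨n, rfl⟩
      · simp only [hG, if_true]
        have hne : ∀ n : ℤ, (-1 / 2 : ℂ) ≠ n := fun n => (hnhalf n).symm
        have ho : IsOpen {u : ℂ | sin (Real.pi * u) ≠ 0} :=
          isOpen_ne_fun (by fun_prop) continuous_const
        have hcsc : AnalyticAt ℂ cscSq (-1 / 2) := by
          refine DifferentiableOn.analyticAt (s := {u : ℂ | sin (Real.pi * u) ≠ 0})
            (fun u hu => ?_)
            (ho.mem_nhds (sin_pi_mul_ne_zero fun ⟨n, h⟩ => hne n h.symm))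
          refine (differentiableAt_cscSq ?_).differentiableWithinAt
          rintro n rfl
          exact hu (by rw [mul_comm]; exact sin_int_mul_pi n)
        exact (hcsc.mul (analyticAt_const_cpow hx _)).mul (by fun_prop)
      · simp only [hG, if_neg (hnhalf n)]
        refine ((analyticAt_pi_sq_div_sinQuot n).mul (analyticAt_const_cpow hx _)).div
          (by fun_prop) fun h => hnhalf n (by linear_combination h))
    (by
      intro s hs
      rcases hSmem _ hs with rfl | ⟨n, rfl⟩
      · filter_upwards [self_mem_nhdsWithin] with z hz
        have hz' : z + 1 / 2 ≠ 0 := fun h => hz (by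
          rw [Set.mem_singleton_iff]; linear_combination h)
        simp only [hG, if_true, reducedIntegrand]
        rw [show z - -1 / 2 = z + 1 / 2 by ring]
        field_simp
      · refine Eventually.of_forall fun z => ?_
        simp only [hG, if_neg (hnhalf n), reducedIntegrand, cscSq_eq_div z n]
        ring)
    (fun u hu hu1 => (norm_reducedIntegrand_le hx hu hu1).trans
      (div_sq_le_div_abs (by positivity) hu1))
    hγ (contDiff_vertical_line (-1 / 4)) hc (R₂ := 0) (fun _ _ => rfl) hM1 hM2
    (havoid hn hh) (havoid hn' hh') (e₁ := fun s => if (-1 / 4 : ℝ) < s.re then 1 else 0)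
    (by
      intro s hs
      rcases hSmem _ hs with rfl | ⟨n, rfl⟩
      · rw [if_neg (by norm_num)]
        exact hhalf
      · rcases lt_or_ge n 0 with h | h
        · have : (n : ℝ) ≤ -1 := by exact_mod_cast Int.le_sub_one_of_lt h
          rw [if_neg (by rw [intCast_re]; linarith)]
          exact hleft n h
        · have : (0 : ℝ) ≤ n := by exact_mod_cast h
          rw [if_pos (by rw [intCast_re]; linarith)]
          exact hright n h)
    (fun s hs => hasSideIndex_vertical_line _ (by
      rcases hSmem _ hs with rfl | ⟨n, rfl⟩
      · norm_num
      · intro h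
        refine ne_intCast_of_re (u := ((-1 / 4 : ℝ) : ℂ)) (-1) (by simp; norm_num)
          (by simp; norm_num) n ?_
        rw [← h]; simp))
    hi (hint (R := 0) (contDiff_vertical_line _) (fun _ _ => rfl) hM2 hn' hh')
  simp only [sub_self, zero_mul, Finset.sum_const_zero, mul_zero, deriv_vertical_line] at key
  rw [sub_eq_zero.1 key, integral_mul_const, mul_comm]

/-! ### The dilogarithm bracket: derivative and limit at the origin. -/

section Dilog

/-- The real function `log (1 - v) / v`, with its removable singularity at `0` removed. -/
def logSlope : ℝ → ℝ := dslope (fun v => Real.log (1 - v)) 0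

theorem logSlope_of_ne {v : ℝ} (hv : v ≠ 0) : logSlope v = Real.log (1 - v) / v := by
  rw [logSlope, dslope_of_ne _ hv, slope_def_field]; simp

theorem continuousOn_logSlope : ContinuousOn logSlope (Set.Iio 1) := by
  rw [logSlope, continuousOn_dslope (Iio_mem_nhds zero_lt_one)]
  constructor
  · refine ContinuousOn.log (by fun_prop) fun v hv => ?_
    have : v < 1 := hv
    linarith
  · exact ((differentiableAt_const _).sub differentiableAt_id).log (by simp)

theorem dilog_ofReal {z : ℝ} (hz : z < 1) : dilog z = ((-∫ v in (0 : ℝ)..z, logSlope v : ℝ) : ℂ) := by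
  have h : ∫ t in (0 : ℝ)..1, log (1 - t * z) / t =
      ∫ t in (0 : ℝ)..1, ((z * logSlope (t * z) : ℝ) : ℂ) := by
    refine intervalIntegral.integral_congr_ae (Eventually.of_forall fun t ht => ?_)
    rw [Set.uIoc_of_le zero_le_one] at ht
    have h1 : 0 ≤ 1 - t * z := by nlinarith [ht.1, ht.2]
    rw [show (1 : ℂ) - t * z = ((1 - t * z : ℝ) : ℂ) by push_cast; ring, ← ofReal_log h1,
      ← ofReal_div]
    congr 1
    rcases eq_or_ne z 0 with rfl | hz0
    · simp
    · rw [logSlope_of_ne (mul_ne_zero ht.1.ne' hz0)]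
      have := ht.1.ne'
      field_simp
  rw [dilog, h, intervalIntegral.integral_ofReal, intervalIntegral.integral_const_mul,
    ← smul_eq_mul z, intervalIntegral.smul_integral_comp_mul_right]
  simp

theorem hasDerivAt_integral_logSlope {z : ℝ} (hz : z < 1) :
    HasDerivAt (fun z => ∫ v in (0 : ℝ)..z, logSlope v) (logSlope z) z := by
  refine intervalIntegral.integral_hasDerivAt_right ?_ ?_ ?_
  · refine (continuousOn_logSlope.mono fun v hv => ?_).intervalIntegrable
    exact hv.2.trans_lt (max_lt zero_lt_one hz)
  · exact continuousOn_logSlope.stronglyMeasurableAtFilter isOpen_Iio z hz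
  · exact continuousOn_logSlope.continuousAt (Iio_mem_nhds hz)

/-- Dominated convergence in the power series, with majorant `1 / (k + 1)²`, and `ζ(2) = π²/6`. The
point `1` lies on the cut, so continuity of `dilog` is not available there. -/
theorem tendsto_dilog_one_sub :
    Tendsto (fun y : ℝ => dilog ((1 - y : ℝ) : ℂ)) (𝓝[>] 0) (𝓝 ((Real.pi : ℂ) ^ 2 / 6)) := by
  have hsum : ∑' k : ℕ, (1 : ℂ) / ((k : ℂ) + 1) ^ 2 = (Real.pi : ℂ) ^ 2 / 6 := by
    have h := (hasSum_nat_add_iff' 1).2 hasSum_zeta_two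
    have h2 := (hasSum_ofReal.2 h).tsum_eq
    rw [Finset.sum_range_one] at h2
    push_cast at h2
    simpa using h2
  have hbound : Summable fun k : ℕ => 1 / ((k : ℝ) + 1) ^ 2 := by
    have := (summable_nat_add_iff 1).2 hasSum_zeta_two.summable
    simpa using this
  have key : Tendsto (fun y : ℝ => ∑' k : ℕ, ((1 - y : ℝ) : ℂ) ^ (k + 1) / ((k : ℂ) + 1) ^ 2)
      (𝓝[>] 0) (𝓝 (∑' k : ℕ, (1 : ℂ) / ((k : ℂ) + 1) ^ 2)) := by
    refine tendsto_tsum_of_dominated_convergence hbound (fun k => ?_) ?_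
    · refine tendsto_nhdsWithin_of_tendsto_nhds ?_
      have : Continuous fun y : ℝ => ((1 - y : ℝ) : ℂ) ^ (k + 1) / ((k : ℂ) + 1) ^ 2 := by fun_prop
      simpa using this.tendsto 0
    · filter_upwards [Ioo_mem_nhdsGT (zero_lt_one' ℝ)] with y hy k
      have h1 : ‖((1 - y : ℝ) : ℂ)‖ ≤ 1 := by
        rw [norm_real, Real.norm_of_nonneg (by linarith [hy.2])]; linarith [hy.1]
      have h2 : ‖((k : ℂ) + 1)‖ = (k : ℝ) + 1 := by
        rw [← Nat.cast_add_one, norm_natCast]; simp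
      rw [norm_div, norm_pow, norm_pow, h2]
      gcongr
      exact pow_le_one₀ (norm_nonneg _) h1
  rw [hsum] at key
  refine key.congr' ?_
  filter_upwards [Ioo_mem_nhdsGT (zero_lt_one' ℝ)] with y hy
  refine (dilog_hasSum ?_).tsum_eq
  rw [norm_real, Real.norm_of_nonneg (by linarith [hy.2])]; linarith [hy.1]

theorem tendsto_log_mul_log_one_add :
    Tendsto (fun y : ℝ => Real.log y * Real.log (1 + y)) (𝓝[>] 0) (𝓝 0) := by
  have h0 : Tendsto (fun y : ℝ => ‖Real.log y * y‖) (𝓝[>] 0) (𝓝 0) := by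
    have := (Real.continuous_mul_log.tendsto 0).mono_left (nhdsWithin_le_nhds (s := Set.Ioi 0))
    simpa [mul_comm] using this.norm
  refine squeeze_zero_norm' ?_ h0
  filter_upwards [self_mem_nhdsWithin] with y hy
  have hy : 0 < y := hy
  rw [norm_mul, norm_mul]
  gcongr
  rw [Real.norm_of_nonneg (Real.log_nonneg (by linarith)), Real.norm_of_nonneg hy.le]
  have := Real.log_le_sub_one_of_pos (show 0 < 1 + y by linarith)
  linarith

/-- The bracket in the closed form, as a function of `y = √x`. -/
def dilogBracket (y : ℝ) : ℂ :=
  (Real.pi : ℂ) ^ 2 / 6 - dilog (1 - y) - dilog (-y) - (Real.log y : ℂ) * (Real.log (1 + y) : ℂ)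

theorem dilogBracket_eq {y : ℝ} (hy : 0 < y) :
    dilogBracket y = ((Real.pi ^ 2 / 6 + (∫ v in (0 : ℝ)..(1 - y), logSlope v) +
      (∫ v in (0 : ℝ)..(-y), logSlope v) - Real.log y * Real.log (1 + y) : ℝ) : ℂ) := by
  rw [dilogBracket, show (1 : ℂ) - y = ((1 - y : ℝ) : ℂ) by push_cast; ring, ← ofReal_neg,
    dilog_ofReal (by linarith : 1 - y < 1), dilog_ofReal (by linarith : -y < 1)]
  push_cast
  ring

/-- The term `log (1 + y) / y` from `Li₂(-y)` cancels the one from the product of logarithms. -/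
theorem hasDerivAt_dilogBracket {y : ℝ} (hy : 0 < y) :
    HasDerivAt dilogBracket ((-logSlope (1 - y) - Real.log y / (1 + y) : ℝ) : ℂ) y := by
  have h1 : HasDerivAt (fun y : ℝ => ∫ v in (0 : ℝ)..(1 - y), logSlope v)
      (logSlope (1 - y) * -1) y :=
    (hasDerivAt_integral_logSlope (by linarith : 1 - y < 1)).comp y
      ((hasDerivAt_id y).const_sub 1)
  have h2 : HasDerivAt (fun y : ℝ => ∫ v in (0 : ℝ)..(-y), logSlope v) (logSlope (-y) * -1) y :=
    (hasDerivAt_integral_logSlope (by linarith : -y < 1)).comp y (hasDerivAt_id y).neg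
  have h3 := (Real.hasDerivAt_log hy.ne').mul
    (((hasDerivAt_id y).const_add 1).log (by simp; linarith))
  have h4 := ((((hasDerivAt_const y (Real.pi ^ 2 / 6)).add h1).add h2).sub h3).ofReal_comp
  refine (h4.congr_of_eventuallyEq ?_).congr_deriv ?_
  · filter_upwards [Ioi_mem_nhds hy] with w hw
    exact dilogBracket_eq hw
  · rw [logSlope_of_ne (v := -y) (by linarith)]
    congr 1
    have : (1 + y) ≠ 0 := by positivity
    simp only [id, sub_neg_eq_add]
    field_simp
    ring

theorem tendsto_dilogBracket : Tendsto dilogBracket (𝓝[>] 0) (𝓝 0) := by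
  have h1 : Tendsto (fun y : ℝ => dilog (-(y : ℂ))) (𝓝[>] 0) (𝓝 0) := by
    have hc : ContinuousAt dilog 0 := (dilog_analyticOnNhd 0 (by simp)).continuousAt
    have h0 : dilog 0 = 0 := by simp [dilog]
    have hc2 : ContinuousAt (fun y : ℝ => dilog (-(y : ℂ))) 0 :=
      ContinuousAt.comp_of_eq (g := dilog) (f := fun y : ℝ => -(y : ℂ)) (y := 0) hc
        (by fun_prop) (by simp)
    have := hc2.tendsto.mono_left (nhdsWithin_le_nhds (s := Set.Ioi 0))
    simpa [h0] using this
  have h2 := (continuous_ofReal.tendsto 0).comp tendsto_log_mul_log_one_add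
  have h := ((tendsto_dilog_one_sub.const_sub ((Real.pi : ℂ) ^ 2 / 6)).sub h1).sub h2
  simp only [sub_self, ofReal_zero] at h
  refine h.congr fun y => ?_
  simp [dilogBracket]

end Dilog

/-! ### Evaluation of the integral on the reference line. -/

section Line

/-- The line `Re = -1/4`. -/
def refLine (t : ℝ) : ℂ := (-1 / 4 : ℝ) + t * I

theorem continuous_refLine : Continuous refLine := by unfold refLine; fun_prop

theorem refLine_re (t : ℝ) : (refLine t).re = -1 / 4 := by simp [refLine]

theorem refLine_im (t : ℝ) : (refLine t).im = t := by simp [refLine]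

theorem continuous_cscSq_refLine : Continuous fun t => cscSq (refLine t) :=
  continuous_iff_continuousAt.2 fun t =>
    (differentiableAt_cscSq (ne_intCast_of_re (-1) (by rw [refLine_re]; norm_num)
      (by rw [refLine_re]; norm_num))).continuousAt.comp continuous_refLine.continuousAt

theorem integrable_cscSq_refLine : Integrable fun t => cscSq (refLine t) := by
  refine integrable_of_continuous_of_le_div_sq continuous_cscSq_refLine (R := 1) (C := 1)
    fun t ht => ?_
  have := norm_cscSq_le (u := refLine t) (by rw [refLine_im]; exact abs_pos.1 (by linarith))
  rwa [refLine_im] at this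

/-- The integral of `reducedIntegrand` along the line `Re = -1/4`, times `x ^ (1/2)`. -/
def lineValue (x : ℝ) : ℂ :=
  ∫ t : ℝ, cscSq (refLine t) * ((x : ℂ) ^ (refLine t - 1 / 2 + 1) / (refLine t - 1 / 2 + 1))

/-- The exponent, which is also the denominator, has real part `1/4`. Its positivity makes
`lineValue` vanish at `0+`. -/
theorem norm_lineValue_integrand_le {x : ℝ} (hx : 0 < x) (t : ℝ) :
    ‖cscSq (refLine t) * ((x : ℂ) ^ (refLine t - 1 / 2 + 1) / (refLine t - 1 / 2 + 1))‖ ≤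
      4 * x ^ (1 / 4 : ℝ) * ‖cscSq (refLine t)‖ := by
  have hre : (refLine t - 1 / 2 + 1).re = 1 / 4 := by
    simp [refLine_re]; norm_num
  have h1 : 1 / 4 ≤ ‖refLine t - 1 / 2 + 1‖ := by
    have := re_le_norm (refLine t - 1 / 2 + 1)
    rwa [hre] at this
  rw [norm_mul, norm_div, norm_cpow_eq_rpow_re_of_pos hx, hre, mul_comm]
  gcongr
  rw [div_le_iff₀ (by linarith)]
  have := Real.rpow_nonneg hx.le (1 / 4)
  nlinarith

theorem continuous_cpow_refLine {x : ℝ} (hx : 0 < x) (w : ℂ) :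
    Continuous fun t => (x : ℂ) ^ (refLine t + w) := by
  have h0 : (x : ℂ) ≠ 0 := by exact_mod_cast hx.ne'
  exact (continuous_refLine.add continuous_const).const_cpow (Or.inl h0)

theorem hasDerivAt_lineValue {x : ℝ} (hx : 0 < x) :
    HasDerivAt lineValue (∫ t : ℝ, cscSq (refLine t) * (x : ℂ) ^ (refLine t - 1 / 2)) x := by
  have hcont : ∀ y : ℝ, 0 < y → Continuous fun t : ℝ =>
      cscSq (refLine t) * ((y : ℂ) ^ (refLine t - 1 / 2 + 1) / (refLine t - 1 / 2 + 1)) := by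
    intro y hy
    have h1 := continuous_cpow_refLine hy (-1 / 2 + 1)
    have h2 := continuous_refLine
    refine continuous_cscSq_refLine.mul (Continuous.div ?_ (by fun_prop) fun t h => ?_)
    · exact h1.congr fun t => by congr 1; ring
    · have := congrArg re h
      simp [refLine_re] at this
      norm_num at this
  refine (hasDerivAt_integral_of_dominated_loc_of_deriv_le (μ := volume) (s := Set.Ioi (x / 2))
    (F := fun (y t : ℝ) =>
      cscSq (refLine t) * ((y : ℂ) ^ (refLine t - 1 / 2 + 1) / (refLine t - 1 / 2 + 1)))
    (F' := fun (y t : ℝ) => cscSq (refLine t) * (y : ℂ) ^ (refLine t - 1 / 2))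
    -- After differentiation the power has real exponent `-3/4`; being decreasing, it is largest at
    -- the left end `x / 2`.
    (bound := fun t => (x / 2) ^ (-3 / 4 : ℝ) * ‖cscSq (refLine t)‖)
    (Ioi_mem_nhds (half_lt_self hx)) ?_ ?_ ?_ ?_ ?_ ?_).2
  · filter_upwards [Ioi_mem_nhds hx] with y hy
    exact (hcont y hy).aestronglyMeasurable
  · exact (integrable_cscSq_refLine.norm.const_mul (4 * x ^ (1 / 4 : ℝ))).mono'
      (hcont x hx).aestronglyMeasurable
      (Eventually.of_forall fun t => norm_lineValue_integrand_le hx t)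
  · have h1 := continuous_cpow_refLine hx (-1 / 2)
    refine (continuous_cscSq_refLine.mul (h1.congr fun t => ?_)).aestronglyMeasurable
    congr 1; ring
  · refine Eventually.of_forall fun t y hy => ?_
    have hy' : x / 2 < y := hy
    have hre : (refLine t - 1 / 2).re = -3 / 4 := by simp [refLine_re]; norm_num
    rw [norm_mul, norm_cpow_eq_rpow_re_of_pos (by linarith), hre, mul_comm]
    exact mul_le_mul_of_nonneg_right
      (Real.rpow_le_rpow_of_nonpos (by linarith) hy'.le (by norm_num)) (norm_nonneg _)
  · exact integrable_cscSq_refLine.norm.const_mul _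
  · refine Eventually.of_forall fun t y hy => ?_
    have hy' : x / 2 < y := hy
    have hy0 : y ≠ 0 := by linarith
    refine (hasDerivAt_ofReal_cpow_const' hy0 fun h => ?_).const_mul _
    have := congrArg re h
    simp [refLine_re] at this
    norm_num at this

theorem tendsto_lineValue : Tendsto lineValue (𝓝[>] 0) (𝓝 0) := by
  have h0 : Tendsto (fun x : ℝ => 4 * x ^ (1 / 4 : ℝ) * ∫ t, ‖cscSq (refLine t)‖) (𝓝[>] 0) (𝓝 0) := by
    have hc : ContinuousAt (fun x : ℝ => 4 * x ^ (1 / 4 : ℝ) * ∫ t, ‖cscSq (refLine t)‖) 0 :=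
      (continuousAt_const.mul (Real.continuousAt_rpow_const _ _ (Or.inr (by norm_num)))).mul
        continuousAt_const
    have := hc.tendsto.mono_left (nhdsWithin_le_nhds (s := Set.Ioi 0))
    simpa using this
  refine squeeze_zero_norm' ?_ h0
  filter_upwards [self_mem_nhdsWithin] with x hx
  rw [← integral_const_mul]
  exact norm_integral_le_of_norm_le (integrable_cscSq_refLine.norm.const_mul _)
    (Eventually.of_forall fun t => norm_lineValue_integrand_le hx t)

theorem hasDerivAt_lineValue_sq {y : ℝ} (hy : 0 < y) (hy1 : y ≠ 1) :
    HasDerivAt (fun y : ℝ => lineValue (y ^ 2))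
      ((2 * Real.pi * (4 * Real.log y / (y ^ 2 - 1)) : ℝ) : ℂ) y := by
  have hx : 0 < y ^ 2 := by positivity
  have h := HasDerivAt.scomp (g₁ := lineValue) (h := fun y : ℝ => y ^ 2) y (hasDerivAt_lineValue hx)
    (hasDerivAt_pow 2 y)
  refine h.congr_deriv ?_
  have h1 := sub_one_mul_integral_cscSq_mul_cpow hx
  have hyc : (y : ℂ) ≠ 0 := by exact_mod_cast hy.ne'
  have hroot : ((y ^ 2 : ℝ) : ℂ) ^ (-1 / 2 : ℂ) = (y : ℂ)⁻¹ := by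
    rw [show (-1 / 2 : ℂ) = ((-1 / 2 : ℝ) : ℂ) by push_cast; ring, ← ofReal_cpow hx.le,
      ← Real.rpow_natCast, ← Real.rpow_mul hy.le, ← ofReal_inv, ← Real.rpow_neg_one]
    norm_num
  have h2 : ∀ t, cscSq (refLine t) * ((y ^ 2 : ℝ) : ℂ) ^ (refLine t - 1 / 2) =
      (y : ℂ)⁻¹ * (cscSq (refLine t) * ((y ^ 2 : ℝ) : ℂ) ^ refLine t) := by
    intro t
    rw [← hroot, sub_eq_add_neg, cpow_add _ _ (by exact_mod_cast hx.ne'),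
      show -(1 / 2 : ℂ) = -1 / 2 by ring]
    ring
  simp only [h2, integral_const_mul]
  change ((y ^ 2 : ℝ) - 1 : ℂ) * (∫ t, cscSq (refLine t) * ((y ^ 2 : ℝ) : ℂ) ^ refLine t) = _ at h1
  have hne : ((y : ℂ) ^ 2 - 1) ≠ 0 := by
    have : y ^ 2 - 1 ≠ 0 := fun h => hy1 (by nlinarith)
    exact_mod_cast this
  rw [Real.log_pow] at h1
  push_cast at h1 ⊢
  rw [real_smul]
  push_cast
  field_simp
  linear_combination h1

/-- A function on the positive half-line with vanishing derivative off one point, which tends to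
zero at the origin, vanishes. -/
theorem eq_zero_of_hasDerivAt_zero {f : ℝ → ℂ} {p : ℝ} (hf : ContinuousOn f (Set.Ioi 0))
    (hd : ∀ y, 0 < y → y ≠ p → HasDerivAt f 0 y) (h0 : Tendsto f (𝓝[>] 0) (𝓝 0)) {y : ℝ}
    (hy : 0 < y) : f y = 0 := by
  refine tendsto_nhds_unique (tendsto_const_nhds.congr' ?_) h0
  filter_upwards [Ioo_mem_nhdsGT hy] with z hz
  have h := integral_eq_of_hasDerivAt_off_countable f (fun _ => 0) (a := z) (b := y)
    (Set.countable_singleton p)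
    (hf.mono fun w hw => by
      rw [Set.uIcc_of_le hz.2.le] at hw
      exact hz.1.trans_le hw.1)
    (fun w hw => by
      rw [min_eq_left hz.2.le, max_eq_right hz.2.le] at hw
      exact hd w (hz.1.trans hw.1.1) hw.2)
    (by simp)
  simp only [intervalIntegral.integral_zero] at h
  exact (sub_eq_zero.1 h.symm)

/-- Both sides have the same derivative and the same limit at `0+`. At `y = 1` the shift relation
degenerates to `0 = 0`, so only continuity is used there. -/
theorem lineValue_sq {y : ℝ} (hy : 0 < y) :
    lineValue (y ^ 2) = 2 * Real.pi * (2 * dilogBracket y) := by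
  refine sub_eq_zero.1 (eq_zero_of_hasDerivAt_zero (p := 1)
    (f := fun y => lineValue (y ^ 2) - 2 * Real.pi * (2 * dilogBracket y)) ?_ ?_ ?_ hy)
  · intro w hw
    have hw : 0 < w := hw
    have h1 : ContinuousAt (fun y : ℝ => lineValue (y ^ 2)) w :=
      ContinuousAt.comp_of_eq (g := lineValue) (f := fun y : ℝ => y ^ 2)
        (hasDerivAt_lineValue (pow_pos hw 2)).continuousAt (by fun_prop) rfl
    exact (h1.sub (continuousAt_const.mul (continuousAt_const.mul
      (hasDerivAt_dilogBracket hw).continuousAt))).continuousWithinAt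
  · intro w hw hw1
    refine ((hasDerivAt_lineValue_sq hw hw1).sub
      (((hasDerivAt_dilogBracket hw).const_mul 2).const_mul (2 * Real.pi : ℂ))).congr_deriv ?_
    have h1 : 1 - w ≠ 0 := sub_ne_zero.2 hw1.symm
    have h2 : 1 + w ≠ 0 := by positivity
    rw [logSlope_of_ne h1, sub_sub_cancel]
    norm_cast
    rw [show w ^ 2 - 1 = -((1 - w) * (1 + w)) by ring]
    field_simp
    ring
  · have hsq : Tendsto (fun y : ℝ => y ^ 2) (𝓝[>] 0) (𝓝[>] 0) := by
      refine tendsto_nhdsWithin_iff.2 ⟨?_, ?_⟩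
      · have := (continuous_pow 2 : Continuous fun y : ℝ => y ^ 2).tendsto 0
        simpa using this.mono_left nhdsWithin_le_nhds
      · filter_upwards [self_mem_nhdsWithin] with y hy
        exact pow_pos (Set.mem_Ioi.1 hy) 2
    simpa using (tendsto_lineValue.comp hsq).sub
      ((tendsto_dilogBracket.const_mul 2).const_mul (2 * Real.pi : ℂ))

theorem integral_reducedIntegrand_refLine {x : ℝ} (hx : 0 < x) :
    ∫ t : ℝ, reducedIntegrand x ((-1 / 4 : ℝ) + t * I) =
      2 * Real.pi * ((x ^ (-1 / 2 : ℝ) : ℝ) * (2 * dilogBracket √x)) := by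
  have hxc : (x : ℂ) ≠ 0 := by exact_mod_cast hx.ne'
  have h := lineValue_sq (Real.sqrt_pos.2 hx)
  rw [Real.sq_sqrt hx.le] at h
  rw [mul_left_comm, ← h, lineValue, ← integral_const_mul]
  refine integral_congr_ae (Eventually.of_forall fun t => ?_)
  change reducedIntegrand x (refLine t) = _
  simp only [reducedIntegrand]
  rw [ofReal_cpow hx.le, show refLine t - 1 / 2 + 1 = refLine t + 1 / 2 by ring,
    show (x : ℂ) ^ refLine t = (x : ℂ) ^ ((-1 / 2 : ℝ) : ℂ) * (x : ℂ) ^ (refLine t + 1 / 2) by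
      rw [← cpow_add _ _ hxc]; congr 1; push_cast; ring]
  ring

end Line

/-! ### Reduction of the Gamma quotient, and the theorem. -/

theorem Gamma_mul_Gamma_sq_eq_cscSq (u : ℂ) :
    (Gamma (-u) * Gamma (1 + u)) ^ 2 = cscSq u := by
  rw [show 1 + u = 1 - -u by ring, Gamma_mul_Gamma_one_sub, cscSq, mul_neg, sin_neg, div_neg, neg_sq]

theorem meijerIntegrand_eq_reducedIntegrand {a x : ℝ} (hx : 0 < x) {s : ℂ}
    (hs : ∀ k : ℕ, s - a ≠ -1 / 2 - k) :
    meijerIntegrand 2 3 ![(a : ℂ) + 1 / 2, (a : ℂ), (a : ℂ)] ![(a : ℂ), (a : ℂ), (a : ℂ) - 1 / 2]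
      x s = ((x ^ a : ℝ) : ℂ) * reducedIntegrand x (s - a) := by
  have hxc : (x : ℂ) ≠ 0 := by exact_mod_cast hx.ne'
  have h0 : s - a + 1 / 2 ≠ 0 := fun h => hs 0 (by push_cast; linear_combination h)
  -- All `k` must be excluded, not only the surviving pole `k = 0`: `Gamma` is `0` by convention at
  -- its poles, and the cancellation would fail.
  have hG : Gamma (s - a + 1 / 2) ≠ 0 := Gamma_ne_zero fun k h => hs k (by linear_combination h)
  have hx1 : (x : ℂ) ^ s = ((x ^ a : ℝ) : ℂ) * (x : ℂ) ^ (s - a) := by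
    rw [ofReal_cpow hx.le, ← cpow_add _ _ hxc]; congr 1; ring
  simp only [meijerIntegrand, Finset.prod_filter, Fin.prod_univ_three, reducedIntegrand,
    ← Gamma_mul_Gamma_sq_eq_cscSq, hx1]
  simp only [Fin.isValue, Fin.val_zero, Fin.val_one, Fin.val_two, Matrix.cons_val_zero,
    Matrix.cons_val_one, Matrix.cons_val]
  norm_num
  rw [show 1 - ((a : ℂ) + 1 / 2) + s = s - a + 1 / 2 by ring,
    show 1 - ((a : ℂ) - 1 / 2) + s = (s - a + 1 / 2) + 1 by ring, Gamma_add_one _ h0,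
    show 1 - (a : ℂ) + s = 1 + (s - a) by ring]
  generalize Gamma (s - a + 1 / 2) = g at hG ⊢
  generalize s - a + 1 / 2 = w at h0 ⊢
  field_simp

theorem HasSideIndex.sub_const {γ : ℝ → ℂ} {c a : ℝ} {z e : ℂ} (h : HasSideIndex γ c (a + z) e) :
    HasSideIndex (fun t => γ t - a) (c - a) z e := by
  filter_upwards [h] with T hT
  simp only [deriv_sub_const, sub_sub]
  rw [hT, ofReal_sub, show (c : ℂ) + T * I - (a + z) = c - a + T * I - z by ring,
    show (c : ℂ) - T * I - (a + z) = c - a - (T * I + z) by ring, sub_sub]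

theorem corollary3p1 (a x : ℝ) (hx : 0 < x) :
    HasMeijerG 2 3
      ![(a : ℂ) + 1 / 2, (a : ℂ), (a : ℂ)] ![(a : ℂ), (a : ℂ), (a : ℂ) - 1 / 2] x
      (2 * ((x ^ (a - 1 / 2) : ℝ) : ℂ) *
        ((Real.pi : ℂ) ^ 2 / 6 - dilog (1 - (√x : ℝ)) - dilog (-(√x : ℝ))
          - (Real.log √x : ℂ) * (Real.log (1 + √x) : ℂ))) := by
  constructor
  -- The line lies between the rightmost left pole `a - 1/2` and the leftmost right pole `a`.
  · set γ : ℝ → ℂ := fun t => ((a - 1 / 4 : ℝ) : ℂ) + t * I with hγ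
    have hre : ∀ t, (γ t).re = a - 1 / 4 := fun t => by simp [hγ]
    have hright : ∀ s : ℂ, a - 1 / 4 < s.re →
        ∀ᶠ r : ℝ in atTop, JoinedIn (Set.range γ)ᶜ s (r : ℂ) := by
      intro s hs
      filter_upwards [eventually_gt_atTop (a - 1 / 4)] with r hr
      refine (JoinedIn.of_segment_subset
        ((convex_halfSpace_re_gt (a - 1 / 4)).segment_subset hs (by simpa using hr))).mono ?_
      rintro _ hu ⟨t, rfl⟩
      exact absurd (hre t) (ne_of_gt hu)
    have hleft : ∀ s : ℂ, s.re < a - 1 / 4 →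
        ∀ᶠ r : ℝ in atBot, JoinedIn (Set.range γ)ᶜ s (r : ℂ) := by
      intro s hs
      filter_upwards [eventually_lt_atBot (a - 1 / 4)] with r hr
      refine (JoinedIn.of_segment_subset
        ((convex_halfSpace_re_lt (a - 1 / 4)).segment_subset hs (by simpa using hr))).mono ?_
      rintro _ hu ⟨t, rfl⟩
      exact absurd (hre t) (ne_of_lt hu)
    refine ⟨γ, contDiff_vertical_line _, ⟨_, 0, fun _ _ => rfl⟩, ?_, ?_⟩
    · rintro j hj s ⟨k, hk⟩
      refine hright s ?_
      have hk' := congrArg re hk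
      have hk0 : (0 : ℝ) ≤ k := k.cast_nonneg
      fin_cases j <;> simp at hj hk' <;> linarith
    · rintro j hj s ⟨k, hk⟩
      refine hleft s ?_
      have hk' := congrArg re hk
      have hk0 : (0 : ℝ) ≤ k := k.cast_nonneg
      fin_cases j <;> simp at hk' <;> linarith
  · rintro γ ⟨hγ, ⟨c, R, hc⟩, hright, hleft⟩
    have hnonneg : ∀ n : ℤ, 0 ≤ n →
        ∀ᶠ r : ℝ in atTop, JoinedIn (Set.range γ)ᶜ ((a : ℂ) + n) r := by
      intro n hn
      lift n to ℕ using hn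
      exact hright 0 (by simp) _ ⟨n, by simp⟩
    have hneg : ∀ n : ℤ, n < 0 →
        ∀ᶠ r : ℝ in atBot, JoinedIn (Set.range γ)ᶜ ((a : ℂ) + n) r := by
      intro n hn
      obtain ⟨k, rfl⟩ : ∃ k : ℕ, n = -1 - k := ⟨(-1 - n).toNat, by omega⟩
      exact hleft 1 (by simp) _ ⟨k, by simp; ring⟩
    have hhalf : ∀ k : ℕ,
        ∀ᶠ r : ℝ in atBot, JoinedIn (Set.range γ)ᶜ ((a : ℂ) + (-1 / 2 - k)) r := by
      intro k
      exact hleft 0 (by simp) _ ⟨k, by simp; ring⟩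
    -- A point joined to another within the complement lies in it, so the path avoids all poles of
    -- the Gamma factors.
    have hne : ∀ {z : ℂ} {r : ℝ}, JoinedIn (Set.range γ)ᶜ ((a : ℂ) + z) r → ∀ t, γ t - a ≠ z :=
      fun h t ht => h.source_mem ⟨t, by rw [← ht]; ring⟩
    have hn : ∀ t, ∀ n : ℤ, γ t - a ≠ n := by
      intro t n
      rcases lt_or_ge n 0 with h | h
      · exact hne (hneg n h).exists.choose_spec t
      · exact hne (hnonneg n h).exists.choose_spec t
    have hh : ∀ t, ∀ k : ℕ, γ t - a ≠ -1 / 2 - k := fun t k => hne (hhalf k).exists.choose_spec t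
    have hγa : ContDiff ℝ 1 fun t => γ t - a := hγ.sub contDiff_const
    have hca : ∀ t : ℝ, R ≤ |t| → γ t - a = ((c - a : ℝ) : ℂ) + t * I := by
      intro t ht; rw [hc t ht]; push_cast; ring
    obtain ⟨hi, hv⟩ := integral_reducedIntegrand hx hγa hca hn
      (fun t => by simpa using hh t 0)
      (fun n h => (hasSideIndex_one_of_joinedIn hγ hc (hnonneg n h)).sub_const)
      (fun n h => (hasSideIndex_zero_of_joinedIn hγ hc (hneg n h)).sub_const)
      ((hasSideIndex_zero_of_joinedIn hγ hc (by simpa using hhalf 0)).sub_const)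
    have heq : (fun t => meijerIntegrand 2 3 ![(a : ℂ) + 1 / 2, (a : ℂ), (a : ℂ)]
        ![(a : ℂ), (a : ℂ), (a : ℂ) - 1 / 2] x (γ t) * deriv γ t) =
        fun t => ((x ^ a : ℝ) : ℂ) *
          (reducedIntegrand x (γ t - a) * deriv (fun t => γ t - a) t) := by
      funext t
      rw [meijerIntegrand_eq_reducedIntegrand hx (hh t), deriv_sub_const]
      ring
    rw [heq]
    refine ⟨hi.const_mul _, ?_⟩
    rw [integral_const_mul, hv, integral_reducedIntegrand_refLine hx, dilogBracket,
      show a - 1 / 2 = a + -1 / 2 by ring, Real.rpow_add hx]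
    have hpi : (Real.pi : ℂ) ≠ 0 := ofReal_ne_zero.2 Real.pi_ne_zero
    have hI := I_ne_zero
    push_cast
    field_simp

end
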